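/- Let $M$ be a closed (compact, without boundary) smooth $n$-dimensional manifold and let $g$ be a smooth negative-definite metric on $M$, i.e. $-g$ is a Riemannian metric (such a $g$ is automatically complete, since $M$ is compact). Let $(\hat M,\hat g)$ be the cone over $(M,g)$, that is, the pseudo-Riemannian manifold $\hat M=\mathbb{R}_{>0}\times M$ with $$\hat g=(dx_0)^2+x_0^2\, g,$$ where $x_0$ is the standard coordinate on $\mathbb{R}_{>0}$. Then $(\hat M,\hat g)$ is not decomposable: for no point $p\in\hat M$ does there exist a linear subspace $U\subset T_p\hat M$ with $U\neq 0$ and $U\neq T_p\hat M$ such that the restriction of $\hat g$ to $U$ is nondegenerate and $U$ is invariant under the holonomy group at $p$ of the Levi-Civita connection of $\hat g$. -/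

import Mathlib

open Set
open scoped Manifold ContDiff

noncomputable section

namespace PseudoRiem

section General

variable {E : Type*} [NormedAddCommGroup E] [NormedSpace ℝ E]
  {H : Type*} [TopologicalSpace H] {I : ModelWithCorners ℝ E H}
  {M : Type*} [TopologicalSpace M] [ChartedSpace H M]

/-- The differential `E → T_{φ⁻¹(y)} M` at `y` of the inverse `φ⁻¹` of the chart `φ`: it sends the
`i`-th basis vector to the coordinate vector `∂/∂xᵢ`. -/
def chartFrame (I : ModelWithCorners ℝ E H) (e : OpenPartialHomeomorph M H) (y : E) :
    E →L[ℝ] TangentSpace I ((e.extend I).symm y) :=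
  mfderiv 𝓘(ℝ, E) I (e.extend I).symm y

/-- The coordinate expression `y ↦ (g_{ij}(y))`, as a family of bilinear forms on `E`, of a family
of bilinear forms on the tangent spaces of `M`. -/
def coordForm (b : ∀ x : M, TangentSpace I x →L[ℝ] TangentSpace I x →L[ℝ] ℝ)
    (e : OpenPartialHomeomorph M H) (y : E) : E →L[ℝ] E →L[ℝ] ℝ :=
  ContinuousLinearMap.precomp ℝ (chartFrame I e y) ∘L b ((e.extend I).symm y) ∘L chartFrame I e y

theorem coordForm_apply (b : ∀ x : M, TangentSpace I x →L[ℝ] TangentSpace I x →L[ℝ] ℝ)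
    (e : OpenPartialHomeomorph M H) (y u v : E) :
    coordForm b e y u v = b ((e.extend I).symm y) (chartFrame I e y u) (chartFrame I e y v) := rfl

theorem mdifferentiableAt_chart_symm [IsManifold I ∞ M] [I.Boundaryless]
    {e : OpenPartialHomeomorph M H} (he : e ∈ atlas H M) {y : E} (hy : y ∈ (e.extend I).target) :
    MDifferentiableAt 𝓘(ℝ, E) I (e.extend I).symm y := by
  have h := contMDiffOn_extend_symm (I := I) (n := ∞) (IsManifold.subset_maximalAtlas he)
  rw [← OpenPartialHomeomorph.extend_target'] at h
  exact (h.contMDiffAt ((OpenPartialHomeomorph.isOpen_extend_target e).mem_nhds hy)).mdifferentiableAt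
    (by simp)

variable (I M) in
/-- A (smooth) pseudo-Riemannian metric on a manifold without boundary: a nondegenerate symmetric
bilinear form on every tangent space, whose coordinate expressions `g_{ij}` are smooth. -/
structure Metric where
  /-- the bilinear form on each tangent space -/
  val : ∀ x : M, TangentSpace I x →L[ℝ] TangentSpace I x →L[ℝ] ℝ
  symm : ∀ x (v w : TangentSpace I x), val x v w = val x w v
  nondegenerate : ∀ x (v : TangentSpace I x), (∀ w, val x v w = 0) → v = 0
  smooth : ∀ e ∈ atlas H M, ContDiffOn ℝ ∞ (coordForm val e) (e.extend I).target

/-- The metric `g` is negative-definite, i.e. `-g` is a Riemannian metric. -/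
def Metric.IsNegativeDefinite (g : Metric I M) : Prop :=
  ∀ x (v : TangentSpace I x), v ≠ 0 → g.val x v v < 0

/-- The Christoffel symbols of the first kind of the metric with coordinate expression `G`:
`christoffel G y u v w = ½ (∂_u G(v, w) + ∂_v G(u, w) - ∂_w G(u, v))` is the scalar product with
`w` of the covariant derivative in the direction `u` of the constant vector field `v`. -/
def christoffel (G : E → E →L[ℝ] E →L[ℝ] ℝ) (y u v w : E) : ℝ :=
  (1 / 2) * (fderiv ℝ G y u v w + fderiv ℝ G y v u w - fderiv ℝ G y w u v)

/-- In coordinates in which the metric is `G`, the vector field `v` along the curve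
`c : [0, 1] → E` is parallel for the Levi-Civita connection: for all `t ∈ [0, 1]` one has
`G (v' + Γ(c', v), w) = 0` for all `w`, i.e. `v' + Γ(c', v) = 0`. -/
def IsParallelInCoords (G : E → E →L[ℝ] E →L[ℝ] ℝ) (c v : ℝ → E) : Prop :=
  ∀ t ∈ Icc (0 : ℝ) 1, ∃ v' : E, HasDerivWithinAt v v' (Icc 0 1) t ∧
    ∀ w : E, G (c t) v' w + christoffel G (c t) (derivWithin c (Icc 0 1) t) (v t) w = 0

/-- `IsParallelTransport g p q P`: the linear isomorphism `P : T_p M ≃ T_q M` is the parallel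
transport of the Levi-Civita connection of `g` along some piecewise `C¹` curve from `p` to `q`.
Such a curve is a concatenation of finitely many `C¹` curves, each contained in a chart domain. -/
inductive IsParallelTransport (g : Metric I M) :
    ∀ p q : M, (TangentSpace I p ≃ₗ[ℝ] TangentSpace I q) → Prop
  /-- Transport along the `C¹` curve in a chart domain with coordinate expression `c`: the parallel
  vector field along it that starts with the coordinate vector `ξ` is `v`. -/
  | segment (e : OpenPartialHomeomorph M H) (he : e ∈ atlas H M) (c : ℝ → E)
      (hc : ContDiffOn ℝ 1 c (Icc 0 1)) (hct : ∀ t ∈ Icc (0 : ℝ) 1, c t ∈ (e.extend I).target)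
      (P : TangentSpace I ((e.extend I).symm (c 0)) ≃ₗ[ℝ]
        TangentSpace I ((e.extend I).symm (c 1)))
      (hP : ∀ ξ : E, ∃ v : ℝ → E, IsParallelInCoords (coordForm g.val e) c v ∧ v 0 = ξ ∧
        P (chartFrame I e (c 0) ξ) = chartFrame I e (c 1) (v 1)) :
      IsParallelTransport g ((e.extend I).symm (c 0)) ((e.extend I).symm (c 1)) P
  | trans {p q r : M} {P : TangentSpace I p ≃ₗ[ℝ] TangentSpace I q}
      {Q : TangentSpace I q ≃ₗ[ℝ] TangentSpace I r} (hP : IsParallelTransport g p q P)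
      (hQ : IsParallelTransport g q r Q) : IsParallelTransport g p r (P.trans Q)

/-- The holonomy group of `g` at `p`: the group of the parallel transports along all piecewise
`C¹` loops at `p`. -/
def holonomyGroup (g : Metric I M) (p : M) :
    Subgroup (TangentSpace I p ≃ₗ[ℝ] TangentSpace I p) :=
  Subgroup.closure {P | IsParallelTransport g p p P}

/-- The metric `g` is decomposable: for some point `p` there is a proper (nonzero and not the whole
space) nondegenerate subspace of `T_p M` that is invariant with respect to the holonomy group. -/
def Metric.IsDecomposable (g : Metric I M) : Prop :=
  ∃ (p : M) (U : Submodule ℝ (TangentSpace I p)), U ≠ ⊥ ∧ U ≠ ⊤ ∧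
    (∀ u ∈ U, (∀ w ∈ U, g.val p u w = 0) → u = 0) ∧
    ∀ P ∈ holonomyGroup g p, ∀ u ∈ U, P u ∈ U

end General

section Cone

/-- The half-line `ℝ_{>0}`, as an open subset of `ℝ`. -/
abbrev PosReal : TopologicalSpace.Opens ℝ := ⟨Ioi 0, isOpen_Ioi⟩

variable {E : Type*} [NormedAddCommGroup E] [NormedSpace ℝ E]
  {H : Type*} [TopologicalSpace H] {I : ModelWithCorners ℝ E H}
  {M : Type*} [TopologicalSpace M] [ChartedSpace H M]

/-- The standard coordinate `x₀` on `ℝ_{>0} × M`. -/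
def coneCoord (p : PosReal × M) : ℝ := p.1

/-- The differential `dx₀` at `p`. -/
def coneDx (I : ModelWithCorners ℝ E H) (p : PosReal × M) :
    TangentSpace (𝓘(ℝ, ℝ).prod I) p →L[ℝ] ℝ :=
  mfderiv (𝓘(ℝ, ℝ).prod I) 𝓘(ℝ, ℝ) coneCoord p

/-- The differential at `p` of the projection `ℝ_{>0} × M → M`. -/
def coneProj (I : ModelWithCorners ℝ E H) (p : PosReal × M) :
    TangentSpace (𝓘(ℝ, ℝ).prod I) p →L[ℝ] TangentSpace I p.2 :=
  mfderiv (𝓘(ℝ, ℝ).prod I) I Prod.snd p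

/-- The bilinear form `dx₀² + x₀² g` on the tangent space of `ℝ_{>0} × M` at `p`. -/
def coneForm (g : Metric I M) (p : PosReal × M) :
    TangentSpace (𝓘(ℝ, ℝ).prod I) p →L[ℝ] TangentSpace (𝓘(ℝ, ℝ).prod I) p →L[ℝ] ℝ :=
  (coneDx I p).smulRight (coneDx I p) + coneCoord p ^ 2 •
    (ContinuousLinearMap.precomp ℝ (coneProj I p) ∘L g.val p.2 ∘L coneProj I p)

theorem coneForm_apply (g : Metric I M) (p : PosReal × M)
    (v w : TangentSpace (𝓘(ℝ, ℝ).prod I) p) :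
    coneForm g p v w = coneDx I p v * coneDx I p w +
      coneCoord p ^ 2 * g.val p.2 (coneProj I p v) (coneProj I p w) := rfl

theorem posReal_chart_symm {e : OpenPartialHomeomorph PosReal ℝ} (he : e ∈ atlas ℝ PosReal)
    {s : ℝ} (hs : s ∈ e.target) : ((e.symm s : PosReal) : ℝ) = s := by
  obtain ⟨x, rfl⟩ := TopologicalSpace.Opens.chart_eq ⟨⟨1, mem_Ioi.2 one_pos⟩⟩ he
  have := OpenPartialHomeomorph.subtypeRestr_symm_eqOn (chartAt ℝ (x : ℝ))
    ⟨(⟨1, mem_Ioi.2 one_pos⟩ : PosReal)⟩ hs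
  exact this.symm

theorem contMDiff_coneCoord : ContMDiff (𝓘(ℝ, ℝ).prod I) 𝓘(ℝ, ℝ) ∞
    (coneCoord : PosReal × M → ℝ) :=
  (contMDiff_subtype_val (I := 𝓘(ℝ, ℝ)) (U := PosReal)).comp contMDiff_fst

theorem coneDx_apply (p : PosReal × M) (v : TangentSpace (𝓘(ℝ, ℝ).prod I) p) :
    coneDx I p v = v.1 := by
  have h1 : HasMFDerivAt 𝓘(ℝ, ℝ) 𝓘(ℝ, ℝ) (Subtype.val : PosReal → ℝ) p.1
      (ContinuousLinearMap.id ℝ ℝ) := by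
    refine ⟨continuous_subtype_val.continuousAt, ?_⟩
    have ht : (extChartAt 𝓘(ℝ, ℝ) p.1).target ∈ nhds (extChartAt 𝓘(ℝ, ℝ) p.1 p.1) :=
      extChartAt_target_mem_nhds p.1
    have h2 : HasFDerivAt (id : ℝ → ℝ) (ContinuousLinearMap.id ℝ ℝ)
      (extChartAt 𝓘(ℝ, ℝ) p.1 p.1) := hasFDerivAt_id _
    refine (h2.congr_of_eventuallyEq ?_).hasFDerivWithinAt
    filter_upwards [ht] with y hy
    have hy' : y ∈ (chartAt ℝ p.1).target := by simpa using hy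
    exact posReal_chart_symm (chart_mem_atlas ℝ p.1) hy'
  have h2 := h1.comp p (hasMFDerivAt_fst (I := 𝓘(ℝ, ℝ)) (I' := I) p)
  have h3 : coneDx I p = _ := h2.mfderiv
  rw [h3]
  rfl

theorem coneProj_apply (p : PosReal × M) (v : TangentSpace (𝓘(ℝ, ℝ).prod I) p) :
    coneProj I p v = v.2 := by
  simp only [coneProj, mfderiv_snd]
  rfl

theorem coneForm_eq (g : Metric I M) (p : PosReal × M)
    (v w : TangentSpace (𝓘(ℝ, ℝ).prod I) p) :
    coneForm g p v w = v.1 * w.1 + coneCoord p ^ 2 * g.val p.2 v.2 w.2 := by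
  rw [coneForm_apply, coneDx_apply p v, coneDx_apply p w, coneProj_apply p v, coneProj_apply p w]

/-- In the coordinates `(x₀, x)` the cone metric is `dx₀² + x₀² ∑ g_{ij}(x) dxᵢ dxⱼ`. -/
theorem coordForm_coneForm [IsManifold I ∞ M] [I.Boundaryless] (g : Metric I M)
    {e₁ : OpenPartialHomeomorph PosReal ℝ} (he₁ : e₁ ∈ atlas ℝ PosReal)
    {e : OpenPartialHomeomorph M H} (he : e ∈ atlas H M) {y : ℝ × E}
    (hy : y ∈ ((e₁.prod e).extend (𝓘(ℝ, ℝ).prod I)).target) (u v : ℝ × E) :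
    coordForm (I := 𝓘(ℝ, ℝ).prod I) (coneForm g) (e₁.prod e) y u v =
      u.1 * v.1 + y.1 ^ 2 * coordForm g.val e y.2 u.2 v.2 := by
  have hmem : e₁.prod e ∈ atlas (ModelProd ℝ H) (PosReal × M) := ⟨e₁, he₁, e, he, rfl⟩
  have ho : IsOpen ((e₁.prod e).extend (𝓘(ℝ, ℝ).prod I)).target :=
    OpenPartialHomeomorph.isOpen_extend_target (I := 𝓘(ℝ, ℝ).prod I) _
  have hy2 : y.2 ∈ (e.extend I).target := by
    have hy' := hy
    rw [OpenPartialHomeomorph.extend_prod, PartialEquiv.prod_target] at hy'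
    exact hy'.2
  have hd := mdifferentiableAt_chart_symm (I := 𝓘(ℝ, ℝ).prod I) hmem hy
  have hd2 := mdifferentiableAt_chart_symm (I := I) he hy2
  have hx0 : ∀ z ∈ ((e₁.prod e).extend (𝓘(ℝ, ℝ).prod I)).target,
      coneCoord (((e₁.prod e).extend (𝓘(ℝ, ℝ).prod I)).symm z) = z.1 := by
    intro z hz
    rw [OpenPartialHomeomorph.extend_prod, PartialEquiv.prod_target] at hz
    exact posReal_chart_symm he₁ (by simpa using hz.1)
  have hdx : ∀ w : ℝ × E, coneDx I _ (chartFrame (𝓘(ℝ, ℝ).prod I) (e₁.prod e) y w) = w.1 := by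
    intro w
    have h1 := mfderiv_comp y ((contMDiff_coneCoord (I := I)).mdifferentiableAt (by simp)) hd
    have h2 : HasFDerivAt (coneCoord ∘ ((e₁.prod e).extend (𝓘(ℝ, ℝ).prod I)).symm)
        (ContinuousLinearMap.fst ℝ ℝ E) y :=
      hasFDerivAt_fst.congr_of_eventuallyEq (Filter.eventually_of_mem (ho.mem_nhds hy) hx0)
    have h3 := h2.hasMFDerivAt.mfderiv
    rw [h1] at h3
    exact congrArg (fun L : ℝ × E →L[ℝ] ℝ => L w) h3
  have hpr : ∀ w : ℝ × E, coneProj I _ (chartFrame (𝓘(ℝ, ℝ).prod I) (e₁.prod e) y w) =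
      chartFrame I e y.2 w.2 := by
    intro w
    have h1 := mfderiv_comp y (mdifferentiableAt_snd (I := 𝓘(ℝ, ℝ)) (I' := I)) hd
    have h2 := mfderiv_comp (I := 𝓘(ℝ, ℝ × E)) y hd2
      (hasFDerivAt_snd (𝕜 := ℝ) (E := ℝ) (F := E)).hasMFDerivAt.mdifferentiableAt
    have h3 := (hasFDerivAt_snd (𝕜 := ℝ) (E := ℝ) (F := E) (p := y)).hasMFDerivAt.mfderiv
    rw [h3] at h2
    exact congrArg (fun L : ℝ × E →L[ℝ] E => L w) (h1.symm.trans h2)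
  rw [coordForm_apply, coneForm_apply, hdx, hdx, hpr, hpr, hx0 y hy]
  rfl

theorem contDiffOn_smul_aux {E F : Type*} [NormedAddCommGroup E] [NormedSpace ℝ E]
    [NormedAddCommGroup F] [NormedSpace ℝ F] {f : E → ℝ} {h : E → F} {s : Set E}
    (hf : ContDiffOn ℝ ∞ f s) (hh : ContDiffOn ℝ ∞ h s) :
    ContDiffOn ℝ ∞ (fun y => f y • h y) s :=
  hf.smul hh

/-- The cone metric `dx₀² + x₀² g` on `ℝ_{>0} × M`. -/
def coneMetric [IsManifold I ∞ M] [I.Boundaryless] (g : Metric I M) :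
    Metric (𝓘(ℝ, ℝ).prod I) (PosReal × M) where
  val := coneForm g
  symm p v w := by
    rw [coneForm_apply, coneForm_apply, g.symm p.2, mul_comm (coneDx I p v)]
  nondegenerate p v hv := by
    have hp : coneCoord p ≠ 0 := (show (0 : ℝ) < coneCoord p from p.1.2).ne'
    have h1 : v.1 = 0 := by
      have h : (v.1 : ℝ) * 1 + coneCoord p ^ 2 * g.val p.2 v.2 0 = 0 :=
        (coneForm_eq g p v ((1 : ℝ), (0 : E))).symm.trans (hv _)
      rw [map_zero, mul_zero, add_zero, mul_one] at h
      exact h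
    have h2 : v.2 = 0 := by
      refine g.nondegenerate p.2 _ fun w => ?_
      have h : (v.1 : ℝ) * 0 + coneCoord p ^ 2 * g.val p.2 v.2 w = 0 :=
        (coneForm_eq g p v ((0 : ℝ), w)).symm.trans (hv _)
      rw [mul_zero, zero_add] at h
      exact (mul_eq_zero.1 h).resolve_left (pow_ne_zero 2 hp)
    exact Prod.ext h1 h2
  smooth e he := by
    obtain ⟨e₁, he₁, e₂, he₂, rfl⟩ := he
    have h2 : ContDiffOn ℝ ∞ (fun y : ℝ × E => coordForm g.val e₂ y.2)
        ((e₁.prod e₂).extend (𝓘(ℝ, ℝ).prod I)).target := by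
      refine (g.smooth e₂ he₂).comp contDiff_snd.contDiffOn fun y hy => ?_
      rw [OpenPartialHomeomorph.extend_prod, PartialEquiv.prod_target] at hy
      exact hy.2
    have h3 : ContDiffOn ℝ ∞ (fun y : ℝ × E => (coordForm g.val e₂ y.2).bilinearComp
        (ContinuousLinearMap.snd ℝ ℝ E) (ContinuousLinearMap.snd ℝ ℝ E))
        ((e₁.prod e₂).extend (𝓘(ℝ, ℝ).prod I)).target :=
      (contDiffOn_const (c := (ContinuousLinearMap.compL ℝ (ℝ × E) E ℝ).flip
        (ContinuousLinearMap.snd ℝ ℝ E))).clm_comp (h2.clm_comp contDiffOn_const)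
    have h4 : ContDiffOn ℝ ∞ (fun y : ℝ × E => (ContinuousLinearMap.fst ℝ ℝ E).smulRight
        (ContinuousLinearMap.fst ℝ ℝ E) + y.1 ^ 2 • (coordForm g.val e₂ y.2).bilinearComp
        (ContinuousLinearMap.snd ℝ ℝ E) (ContinuousLinearMap.snd ℝ ℝ E))
        ((e₁.prod e₂).extend (𝓘(ℝ, ℝ).prod I)).target :=
      contDiffOn_const.add (contDiffOn_smul_aux (contDiff_fst.pow 2).contDiffOn h3)
    refine h4.congr fun y hy => ?_
    refine ContinuousLinearMap.ext fun u => ContinuousLinearMap.ext fun v => ?_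
    exact coordForm_coneForm g he₁ he₂ hy u v

end Cone

end PseudoRiem

end

set_option maxSynthPendingDepth 3

/-! The cone metric `ĝ` is Lorentzian with one positive direction, so of a proper nondegenerate
invariant subspace and its orthogonal complement at least one is negative definite. The orthogonal
projection onto that one commutes with the holonomy and extends to a parallel field `B` of
projections. By `parallel_projection_eq_zero` such a field vanishes, a contradiction.

To see this, stay in a slice `x₀ = r`, a copy of the compact `M`. The radial field `ξ = x₀ ∂/∂x₀`
satisfies `∇_h ξ = h` (`christoffel_cone`). Put `β = -ĝ(Bξ, ξ) = -ĝ(Bξ, Bξ) ≥ 0` and let `z₂` be the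
slice component of `Bξ`. Since `B` is parallel, `∂_h β = -2 ĝ(Bξ, h) = -2 r² g(z₂, h)`, and
comparing the two expressions for `β` gives `-r⁴ g(z₂, z₂) = r² β + β²`. At a maximum of `β` the
gradient vanishes, so `z₂ = 0` and `β = 0`; hence `β = 0` everywhere and `Bξ = 0`. Differentiating,
`B h = 0` for every slice vector `h`, so `B = 0`.

Covariant derivatives are replaced by parallel frames along short coordinate segments
(`exists_radial_development`): transported back to the initial point, `B` is constant and only `ξ`
moves. As `B` is built by choice, the continuity of `β` has to be derived; it comes from `|∂_h β| ≤
2 (β + r²) |h|`, which controls `log (β + r²)`. Connectedness of `M` is avoided by working on the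
closed set `S` of points joined to the base point. -/

namespace PseudoRiem

/-! ### Linear differential equations on the unit interval. -/

section LinearODE

/-- Linear differential equations with small coefficients are solvable on `[0, 1]`. -/
theorem exists_linear_ode_solution {F : Type*} [NormedAddCommGroup F] [NormedSpace ℝ F]
    [CompleteSpace F] (A : ℝ → F →L[ℝ] F) (hA : ContinuousOn A (Icc 0 1))
    (hb : ∀ t ∈ Icc (0 : ℝ) 1, ‖A t‖ ≤ 1 / 2) (x : F) :
    ∃ α : ℝ → F, α 0 = x ∧
      ∀ t ∈ Icc (0 : ℝ) 1, HasDerivWithinAt α (A t (α t)) (Icc 0 1) t := by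
  -- On the ball of radius `‖x‖` about `x` norms are at most `2‖x‖`, so the bound `1/2` keeps the
  -- speed at most `‖x‖` and the solution inside the ball for unit time.
  have h : IsPicardLindelof (fun t y => A t y) (⟨0, by simp⟩ : Icc (0 : ℝ) 1) x ‖x‖₊ 0 ‖x‖₊
      (1 / 2) := by
    refine ⟨fun t ht => ?_, fun y _ => ?_, fun t ht y hy => ?_, ?_⟩
    · refine ((A t).lipschitz.weaken ?_).lipschitzOnWith
      rw [← NNReal.coe_le_coe]
      simpa using hb t ht
    · exact hA.clm_apply continuousOn_const
    · have h1 : ‖y‖ ≤ ‖x‖ + ‖x‖ := by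
        have := norm_le_norm_add_norm_sub' y x
        rw [Metric.mem_closedBall, dist_eq_norm] at hy
        rw [coe_nnnorm] at hy
        linarith
      calc ‖A t y‖ ≤ ‖A t‖ * ‖y‖ := (A t).le_opNorm y
        _ ≤ 1 / 2 * (‖x‖ + ‖x‖) := by gcongr; exact hb t ht
        _ = _ := by rw [coe_nnnorm]; ring
    · simp
  exact h.exists_eq_forall_mem_Icc_hasDerivWithinAt₀

/-- The fundamental solution of a linear differential equation and its inverse. -/
theorem exists_fundamental_solution {E : Type*} [NormedAddCommGroup E] [NormedSpace ℝ E]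
    [CompleteSpace E] (A : ℝ → E →L[ℝ] E) (hA : ContinuousOn A (Icc 0 1))
    (hb : ∀ t ∈ Icc (0 : ℝ) 1, ‖A t‖ ≤ 1 / 2) :
    ∃ Φ Ψ : ℝ → E →L[ℝ] E, Φ 0 = ContinuousLinearMap.id ℝ E ∧
      Ψ 0 = ContinuousLinearMap.id ℝ E ∧ ∀ t ∈ Icc (0 : ℝ) 1,
      Ψ t ∘L Φ t = ContinuousLinearMap.id ℝ E ∧
      HasDerivWithinAt Φ (-(A t ∘L Φ t)) (Icc 0 1) t ∧
      HasDerivWithinAt Ψ (Ψ t ∘L A t) (Icc 0 1) t := by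
  obtain ⟨Φ, hΦ0, hΦ⟩ := exists_linear_ode_solution
    (fun t => ContinuousLinearMap.compL ℝ E E E (-A t))
    ((ContinuousLinearMap.compL ℝ E E E).continuous.comp_continuousOn hA.neg)
    (fun t ht => by
      refine ContinuousLinearMap.opNorm_le_bound _ (by norm_num) fun B => ?_
      calc ‖(-A t) ∘L B‖ ≤ ‖-A t‖ * ‖B‖ := ContinuousLinearMap.opNorm_comp_le _ _
        _ ≤ 1 / 2 * ‖B‖ := by rw [norm_neg]; gcongr; exact hb t ht)
    (ContinuousLinearMap.id ℝ E)
  -- The inverse is constructed from the equation `Ψ' = Ψ A`, which makes the derivative of `Ψ Φ`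
  -- vanish.
  obtain ⟨Ψ, hΨ0, hΨ⟩ := exists_linear_ode_solution
    (fun t => (ContinuousLinearMap.compL ℝ E E E).flip (A t))
    ((ContinuousLinearMap.compL ℝ E E E).flip.continuous.comp_continuousOn hA)
    (fun t ht => by
      refine ContinuousLinearMap.opNorm_le_bound _ (by norm_num) fun B => ?_
      calc ‖B ∘L A t‖ ≤ ‖B‖ * ‖A t‖ := ContinuousLinearMap.opNorm_comp_le _ _
        _ ≤ ‖B‖ * (1 / 2) := by gcongr; exact hb t ht
        _ = _ := mul_comm _ _)
    (ContinuousLinearMap.id ℝ E)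
  have hΦ' : ∀ t ∈ Icc (0 : ℝ) 1, HasDerivWithinAt Φ (-(A t ∘L Φ t)) (Icc 0 1) t := by
    intro t ht
    have := hΦ t ht
    rwa [ContinuousLinearMap.compL_apply, ContinuousLinearMap.neg_comp] at this
  have hΨ' : ∀ t ∈ Icc (0 : ℝ) 1, HasDerivWithinAt Ψ (Ψ t ∘L A t) (Icc 0 1) t := hΨ
  refine ⟨Φ, Ψ, hΦ0, hΨ0, fun t ht => ⟨?_, hΦ' t ht, hΨ' t ht⟩⟩
  have hd : ∀ s ∈ Icc (0 : ℝ) 1, HasDerivWithinAt (fun s => Ψ s ∘L Φ s) 0 (Icc 0 1) s := by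
    intro s hs
    have := (hΨ' s hs).clm_comp (hΦ' s hs)
    convert this using 1
    rw [ContinuousLinearMap.comp_neg, ContinuousLinearMap.comp_assoc, add_neg_cancel]
  have hc := (convex_Icc (0 : ℝ) 1).norm_image_sub_le_of_norm_hasDerivWithin_le hd (C := 0)
    (fun s _ => by simp) (left_mem_Icc.2 zero_le_one) ht
  rw [zero_mul, norm_le_zero_iff, sub_eq_zero] at hc
  rw [hc, hΦ0, hΨ0, ContinuousLinearMap.id_comp]

end LinearODE

/-! ### Parallel frames along coordinate segments, and metric compatibility. -/

section Coordinates

variable {E : Type*} [NormedAddCommGroup E] [NormedSpace ℝ E]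

/-- The bilinear form `(v, w) ↦ christoffel G y u v w`. -/
noncomputable def christoffelForm (G : E → E →L[ℝ] E →L[ℝ] ℝ) (y u : E) : E →L[ℝ] E →L[ℝ] ℝ :=
  (1 / 2 : ℝ) • (fderiv ℝ G y u + (fderiv ℝ G y).flip u - ((fderiv ℝ G y).flip u).flip)

theorem christoffelForm_apply (G : E → E →L[ℝ] E →L[ℝ] ℝ) (y u v w : E) :
    christoffelForm G y u v w = christoffel G y u v w := rfl

theorem norm_christoffelForm_le (G : E → E →L[ℝ] E →L[ℝ] ℝ) (y u : E) :
    ‖christoffelForm G y u‖ ≤ 2 * ‖fderiv ℝ G y‖ * ‖u‖ := by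
  have h1 := (fderiv ℝ G y).le_opNorm u
  have h2 := (fderiv ℝ G y).flip.le_opNorm u
  rw [ContinuousLinearMap.opNorm_flip] at h2
  have h3 := norm_sub_le (fderiv ℝ G y u + (fderiv ℝ G y).flip u) ((fderiv ℝ G y).flip u).flip
  have h4 := norm_add_le (fderiv ℝ G y u) ((fderiv ℝ G y).flip u)
  rw [ContinuousLinearMap.opNorm_flip] at h3
  have h5 : 0 ≤ ‖fderiv ℝ G y‖ * ‖u‖ := by positivity
  rw [christoffelForm, norm_smul, Real.norm_eq_abs, abs_of_pos (by norm_num)]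
  linarith

/-- `Φ` is a parallel frame along the segment `t ↦ y + t h`, and `Ψ` is the inverse frame. -/
def IsParallelFrame (G : E → E →L[ℝ] E →L[ℝ] ℝ) (y h : E) (Φ Ψ : ℝ → E →L[ℝ] E) : Prop :=
  Φ 0 = ContinuousLinearMap.id ℝ E ∧ Ψ 0 = ContinuousLinearMap.id ℝ E ∧
    ∀ t ∈ Icc (0 : ℝ) 1, Ψ t ∘L Φ t = ContinuousLinearMap.id ℝ E ∧
      ∃ Γ : E →L[ℝ] E, (∀ v w, G (y + t • h) (Γ v) w = christoffel G (y + t • h) h v w) ∧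
        HasDerivWithinAt Φ (-(Γ ∘L Φ t)) (Icc 0 1) t ∧
        HasDerivWithinAt Ψ (Ψ t ∘L Γ) (Icc 0 1) t

/-- Lets the first-kind Christoffel symbols be raised to an endomorphism, with an inverse that
depends continuously on the form. -/
theorem isInvertible_of_nondegenerate [FiniteDimensional ℝ E] (B : E →L[ℝ] E →L[ℝ] ℝ)
    (hB : ∀ v, (∀ w, B v w = 0) → v = 0) : B.IsInvertible := by
  have hinj : Function.Injective (B : E →ₗ[ℝ] E →L[ℝ] ℝ) := by
    rw [← LinearMap.ker_eq_bot, LinearMap.ker_eq_bot']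
    intro v hv
    refine hB v fun w => ?_
    have : B v = 0 := hv
    rw [this]; rfl
  have hd : Module.finrank ℝ E = Module.finrank ℝ (E →L[ℝ] ℝ) := by
    rw [(LinearMap.toContinuousLinearMap (𝕜 := ℝ) (E := E) (F' := ℝ)).symm.finrank_eq]
    exact (Subspace.dual_finrank_eq (K := ℝ) (V := E)).symm
  exact ⟨(LinearEquiv.ofInjectiveOfFinrankEq _ hinj hd).toContinuousLinearEquiv, by ext; rfl⟩

/-- Existence of parallel frames along short segments, locally uniformly. -/
theorem exists_isParallelFrame [FiniteDimensional ℝ E] {G : E → E →L[ℝ] E →L[ℝ] ℝ} {Ω : Set E}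
    (hΩ : IsOpen Ω) (hG : ContDiffOn ℝ ∞ G Ω)
    (hn : ∀ y ∈ Ω, ∀ v, (∀ w, G y v w = 0) → v = 0) {y₀ : E} (hy₀ : y₀ ∈ Ω) :
    ∃ ε > 0, Metric.ball y₀ ε ⊆ Ω ∧ (∃ C, ∀ y ∈ Metric.ball y₀ ε, ‖G y‖ ≤ C) ∧
      ∀ y h, y ∈ Metric.ball y₀ ε → y + h ∈ Metric.ball y₀ ε →
        ∃ Φ Ψ : ℝ → E →L[ℝ] E, IsParallelFrame G y h Φ Ψ := by
  have := FiniteDimensional.complete ℝ E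
  have hinv : ContinuousOn (fun y => (G y).inverse) Ω := fun y hy =>
    ((isInvertible_of_nondegenerate _ (hn y hy)).contDiffAt_map_inverse (n := 1)).continuousAt
      |>.comp_continuousWithinAt (hG.continuousOn y hy)
  have hfd : ContinuousOn (fderiv ℝ G) Ω := hG.continuousOn_fderiv_of_isOpen hΩ (by simp)
  have hbd : ∀ᶠ y in nhds y₀, ‖(G y).inverse‖ * ‖fderiv ℝ G y‖ <
        ‖(G y₀).inverse‖ * ‖fderiv ℝ G y₀‖ + 1 ∧ ‖G y‖ < ‖G y₀‖ + 1 ∧ y ∈ Ω := by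
    have h1 := hinv.continuousAt (hΩ.mem_nhds hy₀)
    have h2 := hfd.continuousAt (hΩ.mem_nhds hy₀)
    have h3 := hG.continuousOn.continuousAt (hΩ.mem_nhds hy₀)
    exact ((h1.norm.mul h2.norm).eventually_lt continuousAt_const (lt_add_one _)).and
      ((h3.norm.eventually_lt continuousAt_const (lt_add_one _)).and (hΩ.mem_nhds hy₀))
  obtain ⟨δ, hδ, hball⟩ := Metric.eventually_nhds_iff_ball.1 hbd
  set K := ‖(G y₀).inverse‖ * ‖fderiv ℝ G y₀‖ + 1 with hK
  have hKpos : 0 < K := by positivity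
  -- Two points of this ball differ by at most `1 / (4 K)`, so the coefficient of the transport
  -- equation is at most `2 K / (4 K) = 1/2`.
  have hε : 0 < min δ (1 / (8 * K)) := lt_min hδ (by positivity)
  have hsub : Metric.ball y₀ (min δ (1 / (8 * K))) ⊆ Metric.ball y₀ δ :=
    Metric.ball_subset_ball (min_le_left _ _)
  refine ⟨_, hε, fun y hy => (hball y (hsub hy)).2.2,
    ⟨‖G y₀‖ + 1, fun y hy => (hball y (hsub hy)).2.1.le⟩, fun y h hy hyh => ?_⟩
  have hseg : ∀ t ∈ Icc (0 : ℝ) 1, y + t • h ∈ Metric.ball y₀ δ := fun t ht =>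
    hsub ((convex_ball y₀ _).add_smul_mem hy hyh ht)
  have hh : ‖h‖ ≤ 1 / (4 * K) := by
    have e1 : ‖h‖ ≤ dist y y₀ + dist (y + h) y₀ := by
      have := dist_triangle_right (y + h) y y₀
      rw [dist_eq_norm, add_sub_cancel_left] at this
      linarith
    have e2 := (Metric.mem_ball.1 hy).trans_le (min_le_right _ _)
    have e3 := (Metric.mem_ball.1 hyh).trans_le (min_le_right _ _)
    have e4 : 1 / (4 * K) = 1 / (8 * K) + 1 / (8 * K) := by field_simp; norm_num
    linarith
  let A : ℝ → E →L[ℝ] E := fun t => (G (y + t • h)).inverse ∘L christoffelForm G (y + t • h) h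
  have hcurve : Continuous fun t : ℝ => y + t • h := by fun_prop
  have hmaps : MapsTo (fun t : ℝ => y + t • h) (Icc 0 1) Ω := fun t ht =>
    (hball _ (hseg t ht)).2.2
  have hA : ContinuousOn A (Icc 0 1) := by
    have h1 := hinv.comp hcurve.continuousOn hmaps
    have h2 := hfd.comp hcurve.continuousOn hmaps
    have h3 : ContinuousOn (fun t : ℝ => christoffelForm G (y + t • h) h) (Icc 0 1) := by
      have h4 : ContinuousOn (fun t : ℝ => (fderiv ℝ G (y + t • h)).flip h) (Icc 0 1) :=
        ((ContinuousLinearMap.flipₗᵢ ℝ E E (E →L[ℝ] ℝ)).continuous.comp_continuousOn h2).clm_apply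
          continuousOn_const
      have h5 : ContinuousOn (fun t : ℝ => ((fderiv ℝ G (y + t • h)).flip h).flip) (Icc 0 1) :=
        (ContinuousLinearMap.flipₗᵢ ℝ E E ℝ).continuous.comp_continuousOn h4
      exact (((h2.clm_apply continuousOn_const).add h4).sub h5).const_smul (1 / 2 : ℝ)
    exact h1.clm_comp h3
  have hAb : ∀ t ∈ Icc (0 : ℝ) 1, ‖A t‖ ≤ 1 / 2 := by
    intro t ht
    have h1 := (hball _ (hseg t ht)).1
    calc ‖A t‖ ≤ ‖(G (y + t • h)).inverse‖ * ‖christoffelForm G (y + t • h) h‖ :=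
          ContinuousLinearMap.opNorm_comp_le _ _
      _ ≤ ‖(G (y + t • h)).inverse‖ * (2 * ‖fderiv ℝ G (y + t • h)‖ * ‖h‖) := by
          gcongr; exact norm_christoffelForm_le _ _ _
      _ = 2 * (‖(G (y + t • h)).inverse‖ * ‖fderiv ℝ G (y + t • h)‖) * ‖h‖ := by ring
      _ ≤ 2 * K * (1 / (4 * K)) := by gcongr
      _ = 1 / 2 := by field_simp; norm_num
  obtain ⟨Φ, Ψ, h1, h2, h3⟩ := exists_fundamental_solution A hA hAb
  refine ⟨Φ, Ψ, h1, h2, fun t ht => ⟨(h3 t ht).1, A t, fun v w => ?_, (h3 t ht).2⟩⟩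
  obtain ⟨e, he⟩ := isInvertible_of_nondegenerate _ (hn _ (hmaps ht))
  have : G (y + t • h) (A t v) = christoffelForm G (y + t • h) h v := by
    simp only [A, ContinuousLinearMap.comp_apply]
    rw [← he, ContinuousLinearMap.inverse_equiv]
    exact e.apply_symm_apply _
  rw [this, christoffelForm_apply]

theorem christoffel_smul (G : E → E →L[ℝ] E →L[ℝ] ℝ) (y u v w : E) (s : ℝ) :
    christoffel G y (s • u) v w = s * christoffel G y u v w := by
  simp only [christoffel, map_smul, _root_.smul_apply, smul_eq_mul]
  ring

/-- Restricting to `[0, s]` and rescaling to `[0, 1]` makes `Φ s` a transport to the intermediate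
point `y + s • h`, so one frame serves all times. -/
theorem IsParallelFrame.isParallelInCoords {G : E → E →L[ℝ] E →L[ℝ] ℝ} {y h : E}
    {Φ Ψ : ℝ → E →L[ℝ] E} (hΦ : IsParallelFrame G y h Φ Ψ) {s : ℝ} (hs : s ∈ Icc (0 : ℝ) 1)
    (ξ : E) : IsParallelInCoords G (fun t => y + t • s • h) (fun t => Φ (t * s) ξ) := by
  intro t ht
  have hts : t * s ∈ Icc (0 : ℝ) 1 := ⟨mul_nonneg ht.1 hs.1, mul_le_one₀ ht.2 hs.1 hs.2⟩
  obtain ⟨_, Γ, hΓ, hd, _⟩ := hΦ.2.2 _ hts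
  have hm : HasDerivWithinAt (fun t : ℝ => t * s) s (Icc 0 1) t := by
    simpa using (hasDerivWithinAt_id t (Icc (0 : ℝ) 1)).mul_const s
  have hmaps : MapsTo (fun t : ℝ => t * s) (Icc 0 1) (Icc 0 1) := fun r hr =>
    ⟨mul_nonneg hr.1 hs.1, mul_le_one₀ hr.2 hs.1 hs.2⟩
  have h1 := hd.scomp t hm hmaps
  have h2 := h1.clm_apply (hasDerivWithinAt_const t (Icc (0 : ℝ) 1) ξ)
  refine ⟨_, h2, fun w => ?_⟩
  have hc : derivWithin (fun t : ℝ => y + t • s • h) (Icc 0 1) t = s • h := by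
    have : HasDerivWithinAt (fun t : ℝ => y + t • s • h) ((1 : ℝ) • s • h) (Icc 0 1) t :=
      ((hasDerivWithinAt_id t _).smul_const _).const_add y
    rw [one_smul] at this
    exact this.derivWithin (uniqueDiffOn_Icc zero_lt_one t ht)
  rw [hc, christoffel_smul]
  simp only [smul_smul]
  rw [← hΓ]
  simp

/-- Parallel transport preserves the metric. -/
theorem IsParallelInCoords.form_eq {G : E → E →L[ℝ] E →L[ℝ] ℝ} {Ω : Set E}
    (hG : ∀ y ∈ Ω, DifferentiableAt ℝ G y) (hs : ∀ y ∈ Ω, ∀ v w, G y v w = G y w v)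
    (hΩ : IsOpen Ω) {c v w : ℝ → E}
    (hc : ContDiffOn ℝ 1 c (Icc 0 1)) (hcΩ : ∀ t ∈ Icc (0 : ℝ) 1, c t ∈ Ω)
    (hv : IsParallelInCoords G c v) (hw : IsParallelInCoords G c w) :
    G (c 1) (v 1) (w 1) = G (c 0) (v 0) (w 0) := by
  have hd : ∀ t ∈ Icc (0 : ℝ) 1,
      HasDerivWithinAt (fun t => G (c t) (v t) (w t)) 0 (Icc 0 1) t := by
    intro t ht
    obtain ⟨v', hv', hv1⟩ := hv t ht
    obtain ⟨w', hw', hw1⟩ := hw t ht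
    have hc' := ((hc.differentiableOn (by simp)) t ht).hasDerivWithinAt
    have h0 : HasDerivWithinAt (fun t => G (c t)) (fderiv ℝ G (c t) (derivWithin c (Icc 0 1) t))
      (Icc 0 1) t := (hG _ (hcΩ t ht)).hasFDerivAt.comp_hasDerivWithinAt t hc'
    have h1 := (h0.clm_apply hv').clm_apply hw'
    refine h1.congr_deriv ?_
    -- With this symmetry, the Christoffel terms for `(c', v, w)` and `(c', w, v)` add up to the
    -- derivative of `G` along `c'`, which cancels.
    have hsymm : ∀ u a b, fderiv ℝ G (c t) u a b = fderiv ℝ G (c t) u b a := by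
      intro u a b
      have e1 := ((hG _ (hcΩ t ht)).hasFDerivAt.clm_apply (hasFDerivAt_const a (c t))).clm_apply
        (hasFDerivAt_const b (c t))
      have e2 := ((hG _ (hcΩ t ht)).hasFDerivAt.clm_apply (hasFDerivAt_const b (c t))).clm_apply
        (hasFDerivAt_const a (c t))
      have e3 := e1.congr_of_eventuallyEq (Filter.eventually_of_mem
        (hΩ.mem_nhds (hcΩ t ht)) fun z hz => (hs z hz b a))
      have := congrArg (fun L : E →L[ℝ] ℝ => L u) (e3.unique e2)
      simpa using this
    have e1 := hv1 (w t)
    have e2 := hw1 (v t)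
    have e3 := hs _ (hcΩ t ht) (v t) w'
    have e4 := hsymm (v t) (derivWithin c (Icc 0 1) t) (w t)
    have e5 := hsymm (w t) (derivWithin c (Icc 0 1) t) (v t)
    have e6 := hsymm (derivWithin c (Icc 0 1) t) (v t) (w t)
    simp only [christoffel] at e1 e2
    simp only [_root_.add_apply]
    linarith
  have := (convex_Icc (0 : ℝ) 1).norm_image_sub_le_of_norm_hasDerivWithin_le hd (C := 0)
    (fun s _ => by simp) (left_mem_Icc.2 zero_le_one) (right_mem_Icc.2 zero_le_one)
  rwa [zero_mul, norm_le_zero_iff, sub_eq_zero] at this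

end Coordinates

/-! ### Parallel transport on a manifold, isometry, and parallel fields of endomorphisms. -/

section Transport

variable {E : Type*} [NormedAddCommGroup E] [NormedSpace ℝ E]
  {H : Type*} [TopologicalSpace H] {I : ModelWithCorners ℝ E H}
  {M : Type*} [TopologicalSpace M] [ChartedSpace H M]

theorem chartFrame_bijective [IsManifold I ∞ M] [I.Boundaryless] [FiniteDimensional ℝ E]
    {e : OpenPartialHomeomorph M H} (he : e ∈ atlas H M) {y : E} (hy : y ∈ (e.extend I).target) :
    Function.Bijective (chartFrame I e y) := by
  have hd := mdifferentiableAt_chart_symm (I := I) he hy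
  have hx : (e.extend I).symm y ∈ e.source := by
    rw [← e.extend_source (I := I)]
    exact (e.extend I).map_target hy
  have hf : MDifferentiableAt I 𝓘(ℝ, E) (e.extend I) ((e.extend I).symm y) :=
    (e.contMDiffAt_extend (n := ∞) (IsManifold.subset_maximalAtlas he) hx).mdifferentiableAt
      (by simp)
  have h1 := mfderiv_comp y hf hd
  have h2 : HasFDerivAt (e.extend I ∘ (e.extend I).symm) (ContinuousLinearMap.id ℝ E) y :=
    (hasFDerivAt_id y).congr_of_eventuallyEq (Filter.eventually_of_mem
      ((OpenPartialHomeomorph.isOpen_extend_target e).mem_nhds hy)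
      fun z hz => (e.extend I).right_inv hz)
  rw [h2.hasMFDerivAt.mfderiv] at h1
  have hinj : Function.Injective (chartFrame I e y) := by
    intro u v huv
    have h3 : ∀ w : E, mfderiv I 𝓘(ℝ, E) (e.extend I) ((e.extend I).symm y) (chartFrame I e y w)
        = w := fun w => (congrArg (fun L : E →L[ℝ] E => L w) h1).symm
    rw [← h3 u, huv, h3 v]
  exact ⟨hinj, LinearMap.injective_iff_surjective.1
    (show Function.Injective (show E →ₗ[ℝ] E from (chartFrame I e y).toLinearMap) from hinj)⟩

theorem coordForm_nondegenerate [IsManifold I ∞ M] [I.Boundaryless] [FiniteDimensional ℝ E]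
    (g : Metric I M) {e : OpenPartialHomeomorph M H} (he : e ∈ atlas H M) {y : E}
    (hy : y ∈ (e.extend I).target) (v : E) (hv : ∀ w, coordForm g.val e y v w = 0) : v = 0 := by
  have hb := chartFrame_bijective (I := I) he hy
  refine hb.1 ?_
  rw [map_zero]
  refine g.nondegenerate _ _ fun w => ?_
  obtain ⟨w, rfl⟩ := hb.2 w
  exact hv w

/-- Allows endpoints that equal `c 0` and `c 1` only propositionally, without casting `P` between
tangent spaces. -/
theorem IsParallelTransport.of_segment {g : Metric I M} {e : OpenPartialHomeomorph M H}
    (he : e ∈ atlas H M) {c : ℝ → E} (hc : ContDiffOn ℝ 1 c (Icc 0 1))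
    (hct : ∀ t ∈ Icc (0 : ℝ) 1, c t ∈ (e.extend I).target) {y y' : E} (hy : c 0 = y)
    (hy' : c 1 = y')
    (P : TangentSpace I ((e.extend I).symm y) ≃ₗ[ℝ] TangentSpace I ((e.extend I).symm y'))
    (hP : ∀ ξ : E, ∃ v : ℝ → E, IsParallelInCoords (coordForm g.val e) c v ∧ v 0 = ξ ∧
        P (chartFrame I e y ξ) = chartFrame I e y' (v 1)) :
    IsParallelTransport g ((e.extend I).symm y) ((e.extend I).symm y') P := by
  subst hy hy'
  exact .segment e he c hc hct P hP

/-- A parallel frame along a segment in a chart domain induces parallel transports. -/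
theorem IsParallelFrame.exists_isParallelTransport [IsManifold I ∞ M] [I.Boundaryless]
    [FiniteDimensional ℝ E] {g : Metric I M} {e : OpenPartialHomeomorph M H} (he : e ∈ atlas H M)
    {y h : E} (hyh : ∀ t ∈ Icc (0 : ℝ) 1, y + t • h ∈ (e.extend I).target)
    {Φ Ψ : ℝ → E →L[ℝ] E} (hΦ : IsParallelFrame (coordForm g.val e) y h Φ Ψ)
    {t : ℝ} (ht : t ∈ Icc (0 : ℝ) 1) :
    ∃ Q : TangentSpace I ((e.extend I).symm y) ≃ₗ[ℝ] TangentSpace I ((e.extend I).symm (y + t • h)),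
      IsParallelTransport g ((e.extend I).symm y) ((e.extend I).symm (y + t • h)) Q ∧
      ∀ ξ, Q (chartFrame I e y (Ψ t ξ)) = chartFrame I e (y + t • h) ξ := by
  have hy : y ∈ (e.extend I).target := by simpa using hyh 0 (by simp)
  have hleft : ∀ ξ, Ψ t (Φ t ξ) = ξ := fun ξ =>
    congrArg (fun L : E →L[ℝ] E => L ξ) (hΦ.2.2 t ht).1
  have hinj : Function.Injective (Φ t : E →ₗ[ℝ] E) := Function.LeftInverse.injective hleft
  have hsurj : Function.Surjective (Φ t : E →ₗ[ℝ] E) := LinearMap.injective_iff_surjective.1 hinj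
  let F₀ := LinearEquiv.ofBijective (chartFrame I e y).toLinearMap (chartFrame_bijective he hy)
  let F₁ := LinearEquiv.ofBijective (chartFrame I e (y + t • h)).toLinearMap
    (chartFrame_bijective he (hyh t ht))
  let T := LinearEquiv.ofBijective (Φ t : E →ₗ[ℝ] E) ⟨hinj, hsurj⟩
  have hQ : ∀ ξ, (F₀.symm.trans (T.trans F₁)) (chartFrame I e y ξ) =
      chartFrame I e (y + t • h) (Φ t ξ) := by
    intro ξ
    have : F₀.symm (chartFrame I e y ξ) = ξ := F₀.symm_apply_apply ξ
    rw [LinearEquiv.trans_apply, this]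
    rfl
  refine ⟨F₀.symm.trans (T.trans F₁), ?_, fun ξ => ?_⟩
  · refine IsParallelTransport.of_segment he (c := fun s => y + s • t • h) (by fun_prop)
      (fun s hs => ?_) (by simp) (by simp) _ fun ξ => ⟨fun s => Φ (s * t) ξ,
        hΦ.isParallelInCoords ht ξ, ?_, ?_⟩
    · have := hyh (s * t) ⟨mul_nonneg hs.1 ht.1, mul_le_one₀ hs.2 ht.1 ht.2⟩
      rwa [mul_smul] at this
    · simp [hΦ.1]
    · simp only [hQ, one_mul]
  · obtain ⟨ζ, rfl⟩ := hsurj ξ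
    exact (congrArg _ (congrArg _ (hleft ζ))).trans (hQ ζ)

/-- Parallel transport of the Levi-Civita connection is an isometry. -/
theorem IsParallelTransport.val_eq [IsManifold I ∞ M] [I.Boundaryless] [FiniteDimensional ℝ E]
    {g : Metric I M} {p q : M} {P : TangentSpace I p ≃ₗ[ℝ] TangentSpace I q}
    (hP : IsParallelTransport g p q P) (u v : TangentSpace I p) :
    g.val q (P u) (P v) = g.val p u v := by
  induction hP with
  | segment e he c hc hct P hP =>
    have h0 := hct 0 (by simp)
    obtain ⟨ξ, rfl⟩ := (chartFrame_bijective he h0).2 u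
    obtain ⟨ζ, rfl⟩ := (chartFrame_bijective he h0).2 v
    obtain ⟨a, ha, rfl, ha'⟩ := hP ξ
    obtain ⟨b, hb, rfl, hb'⟩ := hP ζ
    rw [ha', hb']
    have ho : IsOpen (e.extend I).target := OpenPartialHomeomorph.isOpen_extend_target e
    exact IsParallelInCoords.form_eq (G := coordForm g.val e)
      (fun y hy => ((g.smooth e he).differentiableOn (by simp)).differentiableAt (ho.mem_nhds hy))
      (fun y _ v w => g.symm _ _ _) ho hc hct ha hb
  | trans _ _ h1 h2 => rw [LinearEquiv.trans_apply, LinearEquiv.trans_apply, h2, h1]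

theorem val_eq_of_mem_holonomyGroup [IsManifold I ∞ M] [I.Boundaryless] [FiniteDimensional ℝ E]
    {g : Metric I M} {p : M} {P : TangentSpace I p ≃ₗ[ℝ] TangentSpace I p}
    (hP : P ∈ holonomyGroup g p) : ∀ u v : TangentSpace I p, g.val p (P u) (P v) = g.val p u v := by
  refine Subgroup.closure_induction (fun P hP => hP.val_eq) (fun u v => rfl)
    (fun P Q _ _ hP hQ u v => ?_) (fun P _ hP u v => ?_) hP
  · rw [LinearEquiv.mul_apply, LinearEquiv.mul_apply, hP, hQ]
  · rw [← hP, ← LinearEquiv.mul_apply, ← LinearEquiv.mul_apply, mul_inv_cancel]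
    rfl

/-- The points `p` and `q` are joined by parallel transports in both directions. -/
def IsJoined (g : Metric I M) (p q : M) : Prop :=
  (∃ P, IsParallelTransport g p q P) ∧ ∃ Q, IsParallelTransport g q p Q

/-- A holonomy invariant endomorphism of a tangent space extends to a parallel field. -/
theorem exists_parallel_field (g : Metric I M) (p : M)
    (A : TangentSpace I p →ₗ[ℝ] TangentSpace I p)
    (hA : ∀ P ∈ holonomyGroup g p, ∀ u, A (P u) = P (A u)) :
    ∃ B : ∀ q : M, TangentSpace I q →ₗ[ℝ] TangentSpace I q,
      (IsJoined g p p → B p = A) ∧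
      ∀ q q' Q, IsJoined g p q → IsJoined g p q' → IsParallelTransport g q q' Q →
        ∀ u, B q' (Q u) = Q (B q u) := by
  classical
  -- `A` conjugated by a chosen transport from `p` to `q`; the value `0` elsewhere is irrelevant.
  let B : ∀ q : M, TangentSpace I q →ₗ[ℝ] TangentSpace I q := fun q =>
    if h : IsJoined g p q then
      h.1.choose.toLinearMap ∘ₗ A ∘ₗ h.1.choose.symm.toLinearMap else 0
  have hB : ∀ q (h : IsJoined g p q) u, B q u = h.1.choose (A (h.1.choose.symm u)) := by
    intro q h u
    simp only [B, dif_pos h]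
    rfl
  refine ⟨B, fun h => LinearMap.ext fun u => ?_, fun q q' Q hq hq' hQ u => ?_⟩
  · have hmem : h.1.choose ∈ holonomyGroup g p := Subgroup.subset_closure h.1.choose_spec
    rw [hB p h, ← hA _ hmem, LinearEquiv.apply_symm_apply]
  -- The return transport `S` closes both routes from `p` to `q'` into loops; `A` commutes with
  -- both, and `S` is cancelled at the end.
  · obtain ⟨S, hS⟩ := hq'.2
    have h1 : (hq.1.choose.trans Q).trans S ∈ holonomyGroup g p :=
      Subgroup.subset_closure ((hq.1.choose_spec.trans hQ).trans hS)
    have h2 : hq'.1.choose.trans S ∈ holonomyGroup g p :=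
      Subgroup.subset_closure (hq'.1.choose_spec.trans hS)
    rw [hB q hq, hB q' hq']
    have h3 := hA _ h1 (hq.1.choose.symm u)
    have h4 := hA _ h2 (hq'.1.choose.symm (Q u))
    simp only [LinearEquiv.trans_apply, LinearEquiv.apply_symm_apply] at h3 h4
    exact S.injective (h4.symm.trans h3)

end Transport

/-! ### The radial field of the cone and its transport along slices. -/

section ConeTransport

variable {E : Type*} [NormedAddCommGroup E] [NormedSpace ℝ E]
  {H : Type*} [TopologicalSpace H] {I : ModelWithCorners ℝ E H}
  {M : Type*} [TopologicalSpace M] [ChartedSpace H M]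

theorem hasDerivAt_form_add_smul {G : E → E →L[ℝ] E →L[ℝ] ℝ} {z : E}
    (hG : DifferentiableAt ℝ G z) (u a b : E) :
    HasDerivAt (fun s : ℝ => G (z + s • u) a b) (fderiv ℝ G z u a b) 0 := by
  have h1 : HasDerivAt (fun s : ℝ => z + s • u) u 0 := by
    simpa using ((hasDerivAt_id (0 : ℝ)).smul_const u).const_add z
  have h2 : HasFDerivAt G (fderiv ℝ G z) (z + (0 : ℝ) • u) := by simpa using hG.hasFDerivAt
  have h3 : HasDerivAt (fun s : ℝ => G (z + s • u)) (fderiv ℝ G z u) 0 :=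
    h2.comp_hasDerivAt (0 : ℝ) h1
  have h4 := (h3.clm_apply (hasDerivAt_const (0 : ℝ) a)).clm_apply (hasDerivAt_const (0 : ℝ) b)
  simpa using h4

/-- For a metric of the form `dx₀² + x₀² g`, the covariant derivative of `x₀ ∂/∂x₀` in the
direction of a vector `h` tangent to the slices is `h`. -/
theorem christoffel_cone {K : ℝ × E → (ℝ × E) →L[ℝ] (ℝ × E) →L[ℝ] ℝ} {G : E → E →L[ℝ] E →L[ℝ] ℝ}
    {Ω : Set (ℝ × E)} (hΩ : IsOpen Ω)
    (hK : ∀ z ∈ Ω, ∀ u v, K z u v = u.1 * v.1 + z.1 ^ 2 * G z.2 u.2 v.2)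
    {z : ℝ × E} (hz : z ∈ Ω) (hd : DifferentiableAt ℝ K z) (h : E) (w : ℝ × E) :
    christoffel K z (0, h) (z.1, 0) w = K z (0, h) w := by
  have hev : ∀ u : ℝ × E, ∀ᶠ s : ℝ in nhds 0, z + s • u ∈ Ω := fun u => by
    have : ContinuousAt (fun s : ℝ => z + s • u) 0 := by fun_prop
    exact this.eventually_mem (hΩ.mem_nhds (by simpa using hz))
  -- Pairing the fixed vector `(z.1, 0)` with a fixed vector gives a constant, so two of the three
  -- derivatives vanish; the third differentiates `x₀²` radially.
  have h1 : fderiv ℝ K z (0, h) (z.1, 0) w = 0 := by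
    refine (hasDerivAt_form_add_smul hd _ _ _).unique
      ((hasDerivAt_const (0 : ℝ) (z.1 * w.1)).congr_of_eventuallyEq ?_)
    filter_upwards [hev (0, h)] with s hs
    rw [hK _ hs]
    simp
  have h2 : fderiv ℝ K z (z.1, 0) (0, h) w = 2 * z.1 ^ 2 * G z.2 h w.2 := by
    have e1 : HasDerivAt (fun s : ℝ => (z.1 + s * z.1) ^ 2 * G z.2 h w.2)
        (2 * z.1 ^ 2 * G z.2 h w.2) 0 := by
      have := ((((hasDerivAt_id (0 : ℝ)).mul_const z.1).const_add z.1).pow 2).mul_const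
        (G z.2 h w.2)
      refine this.congr_deriv ?_
      simp only [id, zero_mul, add_zero, Nat.cast_ofNat]
      ring
    refine (hasDerivAt_form_add_smul hd _ _ _).unique (e1.congr_of_eventuallyEq ?_)
    filter_upwards [hev (z.1, 0)] with s hs
    rw [hK _ hs]
    simp
  have h3 : fderiv ℝ K z w (0, h) (z.1, 0) = 0 := by
    refine (hasDerivAt_form_add_smul hd _ _ _).unique
      ((hasDerivAt_const (0 : ℝ) (0 : ℝ)).congr_of_eventuallyEq ?_)
    filter_upwards [hev w] with s hs
    rw [hK _ hs]
    simp
  rw [christoffel, h1, h2, h3, hK _ hz]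
  ring

theorem chartAt_posReal_apply (r : PosReal) : (chartAt ℝ r) r = (r : ℝ) := by
  have h := posReal_chart_symm (chart_mem_atlas ℝ r) ((chartAt ℝ r).map_source (mem_chart_source ℝ r))
  rw [← h, (chartAt ℝ r).left_inv (mem_chart_source ℝ r)]

theorem mem_target_chartAt_posReal (r : PosReal) : (r : ℝ) ∈ (chartAt ℝ r).target := by
  have h := (chartAt ℝ r).map_source (mem_chart_source ℝ r)
  rwa [chartAt_posReal_apply] at h

theorem chartAt_posReal_symm (r : PosReal) : (chartAt ℝ r).symm (r : ℝ) = r := by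
  have h := (chartAt ℝ r).left_inv (mem_chart_source ℝ r)
  rwa [chartAt_posReal_apply] at h

/-- In a product chart, the coordinate frame of the cone is the product frame. -/
theorem chartFrame_cone [IsManifold I ∞ M] [I.Boundaryless]
    {e₁ : OpenPartialHomeomorph PosReal ℝ} (he₁ : e₁ ∈ atlas ℝ PosReal)
    {e : OpenPartialHomeomorph M H} (he : e ∈ atlas H M) {y : ℝ × E}
    (hy : y ∈ ((e₁.prod e).extend (𝓘(ℝ, ℝ).prod I)).target) (w : ℝ × E) :
    (chartFrame (𝓘(ℝ, ℝ).prod I) (e₁.prod e) y w : ℝ × E) = (w.1, chartFrame I e y.2 w.2) := by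
  have hmem : e₁.prod e ∈ atlas (ModelProd ℝ H) (PosReal × M) := ⟨e₁, he₁, e, he, rfl⟩
  have ho : IsOpen ((e₁.prod e).extend (𝓘(ℝ, ℝ).prod I)).target :=
    OpenPartialHomeomorph.isOpen_extend_target (I := 𝓘(ℝ, ℝ).prod I) _
  have hy2 : y.2 ∈ (e.extend I).target := by
    have hy' := hy
    rw [OpenPartialHomeomorph.extend_prod, PartialEquiv.prod_target] at hy'
    exact hy'.2
  have hd := mdifferentiableAt_chart_symm (I := 𝓘(ℝ, ℝ).prod I) hmem hy
  have hd2 := mdifferentiableAt_chart_symm (I := I) he hy2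
  refine Prod.ext ?_ ?_
  · have hx0 : ∀ z ∈ ((e₁.prod e).extend (𝓘(ℝ, ℝ).prod I)).target,
        coneCoord (((e₁.prod e).extend (𝓘(ℝ, ℝ).prod I)).symm z) = z.1 := by
      intro z hz
      rw [OpenPartialHomeomorph.extend_prod, PartialEquiv.prod_target] at hz
      exact posReal_chart_symm he₁ (by simpa using hz.1)
    have h1 := mfderiv_comp y ((contMDiff_coneCoord (I := I)).mdifferentiableAt (by simp)) hd
    have h2 : HasFDerivAt (coneCoord ∘ ((e₁.prod e).extend (𝓘(ℝ, ℝ).prod I)).symm)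
        (ContinuousLinearMap.fst ℝ ℝ E) y :=
      hasFDerivAt_fst.congr_of_eventuallyEq (Filter.eventually_of_mem (ho.mem_nhds hy) hx0)
    have h3 := h2.hasMFDerivAt.mfderiv
    rw [h1] at h3
    have h4 : coneDx I _ (chartFrame (𝓘(ℝ, ℝ).prod I) (e₁.prod e) y w) = w.1 :=
      congrArg (fun L : ℝ × E →L[ℝ] ℝ => L w) h3
    rwa [coneDx_apply] at h4
  · have h1 := mfderiv_comp y (mdifferentiableAt_snd (I := 𝓘(ℝ, ℝ)) (I' := I)) hd
    have h2 := mfderiv_comp (I := 𝓘(ℝ, ℝ × E)) y hd2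
      (hasFDerivAt_snd (𝕜 := ℝ) (E := ℝ) (F := E)).hasMFDerivAt.mdifferentiableAt
    have h3 := (hasFDerivAt_snd (𝕜 := ℝ) (E := ℝ) (F := E) (p := y)).hasMFDerivAt.mfderiv
    rw [h3] at h2
    have h4 : coneProj I _ (chartFrame (𝓘(ℝ, ℝ).prod I) (e₁.prod e) y w) =
        chartFrame I e y.2 w.2 :=
      congrArg (fun L : ℝ × E →L[ℝ] E => L w) (h1.symm.trans h2)
    rwa [coneProj_apply] at h4

/-- Along short segments in a slice `x₀ = r` of the cone, the radial vector field `x₀ ∂/∂x₀`,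
transported back to the initial point, is differentiable, and its derivative is the velocity
transported back to the initial point. -/
theorem exists_radial_development [IsManifold I ∞ M] [I.Boundaryless] [FiniteDimensional ℝ E]
    (g : Metric I M) (r : PosReal) (m : M) :
    ∃ ε > 0, Metric.ball ((chartAt H m).extend I m) ε ⊆ ((chartAt H m).extend I).target ∧
      (∃ C, ∀ y ∈ Metric.ball ((chartAt H m).extend I m) ε, ∀ h,
        |coordForm g.val (chartAt H m) y h h| ≤ C * ‖h‖ ^ 2) ∧
      ∀ y h, y ∈ Metric.ball ((chartAt H m).extend I m) ε →
        y + h ∈ Metric.ball ((chartAt H m).extend I m) ε →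
        ∃ D : ℝ → ℝ × E, ∀ t ∈ Icc (0 : ℝ) 1, ∃ D' : ℝ × E, HasDerivWithinAt D D' (Icc 0 1) t ∧
          ∃ Q : TangentSpace (𝓘(ℝ, ℝ).prod I)
                ((r, ((chartAt H m).extend I).symm y) : PosReal × M) ≃ₗ[ℝ]
              TangentSpace (𝓘(ℝ, ℝ).prod I)
                ((r, ((chartAt H m).extend I).symm (y + t • h)) : PosReal × M),
            IsParallelTransport (coneMetric g) (r, ((chartAt H m).extend I).symm y)
              (r, ((chartAt H m).extend I).symm (y + t • h)) Q ∧
            (Q (D t) : ℝ × E) = ((r : ℝ), 0) ∧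
            (Q D' : ℝ × E) = (0, chartFrame I (chartAt H m) (y + t • h) h) := by
  set e := chartAt H m
  have he : e ∈ atlas H M := chart_mem_atlas H m
  set e₁ := chartAt ℝ r
  have he₁ : e₁ ∈ atlas ℝ PosReal := chart_mem_atlas ℝ r
  have hmem : e₁.prod e ∈ atlas (ModelProd ℝ H) (PosReal × M) := ⟨e₁, he₁, e, he, rfl⟩
  set Ω := ((e₁.prod e).extend (𝓘(ℝ, ℝ).prod I)).target with hΩ_def
  have hΩ : IsOpen Ω := OpenPartialHomeomorph.isOpen_extend_target (I := 𝓘(ℝ, ℝ).prod I) _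
  have hmemΩ : ∀ z : E, ((r : ℝ), z) ∈ Ω ↔ z ∈ (e.extend I).target := by
    intro z
    rw [hΩ_def, OpenPartialHomeomorph.extend_prod, PartialEquiv.prod_target]
    have := mem_target_chartAt_posReal r
    simp only [mem_prod, and_iff_right_iff_imp]
    intro _
    simpa using this
  have hpt : ∀ z : E, ((e₁.prod e).extend (𝓘(ℝ, ℝ).prod I)).symm ((r : ℝ), z) =
      (r, (e.extend I).symm z) := by
    intro z
    rw [OpenPartialHomeomorph.extend_prod]
    exact Prod.ext (chartAt_posReal_symm r) rfl
  have hm : e.extend I m ∈ (e.extend I).target :=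
    (e.extend I).map_source (by rw [e.extend_source]; exact mem_chart_source H m)
  have hsm := (coneMetric g).smooth _ hmem
  set K := coordForm (I := 𝓘(ℝ, ℝ).prod I) (coneMetric g).val (e₁.prod e)
  have hK : ∀ z ∈ Ω, ∀ u v, K z u v = u.1 * v.1 + z.1 ^ 2 * coordForm g.val e z.2 u.2 v.2 :=
    fun z hz u v => coordForm_coneForm g he₁ he hz u v
  have hnd : ∀ z ∈ Ω, ∀ v, (∀ w, K z v w = 0) → v = 0 := fun z hz v hv =>
    coordForm_nondegenerate (coneMetric g) hmem hz v hv
  obtain ⟨ε, hε, hsub, ⟨C, hC⟩, hfr⟩ := exists_isParallelFrame hΩ hsm hnd ((hmemΩ _).2 hm)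
  have hball : ∀ z : E, ((r : ℝ), z) ∈ Metric.ball ((r : ℝ), e.extend I m) ε ↔
      z ∈ Metric.ball (e.extend I m) ε := by
    intro z
    simp [← ball_prod_same, hε]
  have hr : (0 : ℝ) < r := r.2
  refine ⟨ε, hε, fun z hz => (hmemΩ z).1 (hsub ((hball z).2 hz)), ⟨C / (r : ℝ) ^ 2, ?_⟩, ?_⟩
  · intro y hy h
    have h1 := hC _ ((hball y).2 hy)
    have h2 := hK _ (hsub ((hball y).2 hy)) (0, h) (0, h)
    have h3 := (K ((r : ℝ), y)).le_opNorm₂ (0, h) (0, h)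
    have h4 : ‖((0 : ℝ), h)‖ = ‖h‖ := by simp [Prod.norm_def]
    rw [h2, h4, Real.norm_eq_abs] at h3
    simp only [mul_zero, zero_add, abs_mul, abs_of_pos (pow_pos hr 2)] at h3
    rw [div_mul_eq_mul_div, le_div_iff₀ (pow_pos hr 2)]
    have h5 : ‖K ((r : ℝ), y)‖ * ‖h‖ * ‖h‖ ≤ C * ‖h‖ * ‖h‖ := by gcongr
    nlinarith
  · intro y h hy hyh
    have hadd : ∀ t : ℝ, ((r : ℝ), y) + t • ((0 : ℝ), h) = ((r : ℝ), y + t • h) := by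
      intro t; simp
    obtain ⟨Φ, Ψ, hΦ⟩ := hfr ((r : ℝ), y) (0, h) ((hball y).2 hy) (by
      have := hadd 1
      rw [one_smul, one_smul] at this
      rw [this]
      exact (hball _).2 hyh)
    have hseg : ∀ t ∈ Icc (0 : ℝ) 1, ((r : ℝ), y + t • h) ∈ Ω := fun t ht =>
      hsub ((hball _).2 ((convex_ball _ _).add_smul_mem hy hyh ht))
    let F : ℝ × E →L[ℝ] ℝ × E := chartFrame (𝓘(ℝ, ℝ).prod I) (e₁.prod e) ((r : ℝ), y)
    -- On the slice the radial field has constant coordinates `(r, 0)`, so the derivative of its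
    -- pullback is `Ψ (Γ (r, 0))`, and `Γ (r, 0) = (0, h)`.
    refine ⟨fun t => F (Ψ t ((r : ℝ), 0)), fun t ht =>
      ⟨F (Ψ t (0, h)), ?_, ?_⟩⟩
    · obtain ⟨-, Γ, hΓ, -, hd⟩ := hΦ.2.2 t ht
      have h1 := F.hasFDerivAt.comp_hasDerivWithinAt t
        (hd.clm_apply (hasDerivWithinAt_const t (Icc (0 : ℝ) 1) ((r : ℝ), (0 : E))))
      refine h1.congr_deriv ?_
      have h2 : Γ ((r : ℝ), 0) = (0, h) := by
        rw [← sub_eq_zero]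
        refine hnd _ (hseg t ht) _ fun w => ?_
        have h3 := hΓ ((r : ℝ), 0) w
        rw [hadd] at h3
        rw [map_sub, _root_.sub_apply, h3, sub_eq_zero]
        exact christoffel_cone hΩ hK (hseg t ht)
          ((hsm.differentiableOn (by simp)).differentiableAt (hΩ.mem_nhds (hseg t ht))) h w
      simp [h2]
    · obtain ⟨Q, hQ, hQ'⟩ := hΦ.exists_isParallelTransport hmem
        (fun t ht => by rw [hadd]; exact hseg t ht) ht
      have h1 := hpt y
      have h2 := hpt (y + t • h)
      rw [← hadd] at h2
      have h3 : ∀ ξ : ℝ × E, (Q (F (Ψ t ξ)) : ℝ × E) =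
          (ξ.1, chartFrame I e (y + t • h) ξ.2) := by
        intro ξ
        refine (hQ' ξ).trans ?_
        have h4 := chartFrame_cone (I := I) he₁ he (y := ((r : ℝ), y) + t • ((0 : ℝ), h))
          (by rw [hadd]; exact hseg t ht) ξ
        exact h4
      -- The endpoints are generalized so that substitution can change the types of the tangent
      -- spaces.
      have h5 : ∀ q q' : PosReal × M,
          ((e₁.prod e).extend (𝓘(ℝ, ℝ).prod I)).symm ((r : ℝ), y) = q →
          ((e₁.prod e).extend (𝓘(ℝ, ℝ).prod I)).symm (((r : ℝ), y) + t • ((0 : ℝ), h)) = q' →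
          ∃ Q : TangentSpace (𝓘(ℝ, ℝ).prod I) q ≃ₗ[ℝ] TangentSpace (𝓘(ℝ, ℝ).prod I) q',
            IsParallelTransport (coneMetric g) q q' Q ∧
            ∀ ξ : ℝ × E, (Q (F (Ψ t ξ)) : ℝ × E) =
              (ξ.1, chartFrame I e (y + t • h) ξ.2) := by
        rintro _ _ rfl rfl
        exact ⟨Q, hQ, h3⟩
      obtain ⟨Q', hQ1, hQ2⟩ := h5 _ _ h1 h2
      refine ⟨Q', hQ1, ?_, ?_⟩
      · rw [hQ2, map_zero]
        rfl
      · rw [hQ2]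

end ConeTransport

/-! ### The maximum principle on a slice. -/

section Indecomposability

variable {E : Type*} [NormedAddCommGroup E] [NormedSpace ℝ E]
  {H : Type*} [TopologicalSpace H] {I : ModelWithCorners ℝ E H}
  {M : Type*} [TopologicalSpace M] [ChartedSpace H M]

theorem Metric.IsNegativeDefinite.val_nonpos {g : Metric I M} (hg : g.IsNegativeDefinite) (x : M)
    (v : TangentSpace I x) : g.val x v v ≤ 0 := by
  by_cases hv : v = 0
  · simp [hv]
  · exact (hg x v hv).le

/-- The Cauchy-Schwarz inequality for a negative-definite metric. -/
theorem Metric.IsNegativeDefinite.sq_val_le {g : Metric I M} (hg : g.IsNegativeDefinite) (x : M)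
    (u v : TangentSpace I x) : g.val x u v ^ 2 ≤ g.val x u u * g.val x v v := by
  by_cases hv : v = 0
  · simp [hv]
  · have h1 := hg x v hv
    have h2 := hg.val_nonpos x (g.val x v v • u - g.val x u v • v)
    simp only [map_sub, map_smul, _root_.sub_apply, _root_.smul_apply, smul_eq_mul,
      g.symm x v u] at h2
    have h3 : g.val x v v * (g.val x u u * g.val x v v - g.val x u v ^ 2) ≤ 0 := by linarith
    nlinarith [nonneg_of_mul_nonpos_right h3 h1]

/-- Nearby points of a slice of the cone are joined by parallel transports. -/
theorem exists_nhds_isParallelTransport [IsManifold I ∞ M] [I.Boundaryless]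
    [FiniteDimensional ℝ E] (g : Metric I M) (r : PosReal) (m : M) :
    ∃ U ∈ nhds m, ∀ a ∈ U, ∀ b ∈ U,
      ∃ Q, IsParallelTransport (coneMetric g) ((r, a) : PosReal × M) (r, b) Q := by
  obtain ⟨ε, hε, -, -, hD⟩ := exists_radial_development g r m
  refine ⟨(chartAt H m).source ∩ (chartAt H m).extend I ⁻¹'
    Metric.ball ((chartAt H m).extend I m) ε, Filter.inter_mem
      ((chartAt H m).open_source.mem_nhds (mem_chart_source H m))
      (((chartAt H m).continuousAt_extend (mem_chart_source H m)).preimage_mem_nhds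
        (Metric.ball_mem_nhds _ hε)), fun a ha b hb => ?_⟩
  have hadd : (chartAt H m).extend I a + ((chartAt H m).extend I b - (chartAt H m).extend I a) =
      (chartAt H m).extend I b := add_sub_cancel _ _
  obtain ⟨D, hD⟩ := hD _ ((chartAt H m).extend I b - (chartAt H m).extend I a) ha.2
    (by rw [hadd]; exact hb.2)
  obtain ⟨-, -, Q, hQ, -⟩ := hD 1 (by simp)
  have h : ∃ Q, IsParallelTransport (coneMetric g)
      ((r, ((chartAt H m).extend I).symm ((chartAt H m).extend I a)) : PosReal × M)
      (r, ((chartAt H m).extend I).symm ((chartAt H m).extend I a +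
        (1 : ℝ) • ((chartAt H m).extend I b - (chartAt H m).extend I a))) Q := ⟨Q, hQ⟩
  rw [one_smul, hadd, OpenPartialHomeomorph.extend_left_inv _ ha.1,
    OpenPartialHomeomorph.extend_left_inv _ hb.1] at h
  exact h

/-- A parallel field of orthogonal projections onto negative definite subspaces of the tangent
spaces of the cone over a compact negative-definite manifold vanishes. -/
theorem parallel_projection_eq_zero [IsManifold I ∞ M] [I.Boundaryless] [FiniteDimensional ℝ E]
    [CompactSpace M] (g : Metric I M) (hg : g.IsNegativeDefinite) (p : PosReal × M)
    (A : TangentSpace (𝓘(ℝ, ℝ).prod I) p →ₗ[ℝ] TangentSpace (𝓘(ℝ, ℝ).prod I) p)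
    (hA : ∀ P ∈ holonomyGroup (coneMetric g) p, ∀ u, A (P u) = P (A u))
    (hidem : ∀ u, A (A u) = A u)
    (hself : ∀ u v, (coneMetric g).val p (A u) v = (coneMetric g).val p u (A v))
    (hneg : ∀ u, A u ≠ 0 → (coneMetric g).val p (A u) (A u) < 0) : A = 0 := by
  obtain ⟨r, x₀⟩ := p
  have hr : (0 : ℝ) < r := r.2
  obtain ⟨B, hBp, hB⟩ := exists_parallel_field (coneMetric g) (r, x₀) A hA
  -- Being joined is locally constant on the slice, so `S` is closed, hence compact.
  set S : Set M := {x | IsJoined (coneMetric g) (r, x₀) (r, x)}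
  have hlocal : ∀ m, ∃ U ∈ nhds m, ∀ a ∈ U, a ∈ S → U ⊆ S := by
    intro m
    obtain ⟨U, hU, h⟩ := exists_nhds_isParallelTransport g r m
    refine ⟨U, hU, fun a ha haS b hb => ?_⟩
    obtain ⟨⟨P, hP⟩, ⟨P', hP'⟩⟩ := haS
    obtain ⟨Q, hQ⟩ := h a ha b hb
    obtain ⟨Q', hQ'⟩ := h b hb a ha
    exact ⟨⟨_, hP.trans hQ⟩, ⟨_, hQ'.trans hP'⟩⟩
  have hclosed : IsClosed S := by
    refine isClosed_of_closure_subset fun m hm => ?_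
    obtain ⟨U, hU, h⟩ := hlocal m
    obtain ⟨a, ha, haS⟩ := mem_closure_iff_nhds.1 hm U hU
    exact h a ha haS (mem_of_mem_nhds hU)
  have hx₀ : x₀ ∈ S := by
    obtain ⟨U, hU, h⟩ := exists_nhds_isParallelTransport g r x₀
    have := h x₀ (mem_of_mem_nhds hU) x₀ (mem_of_mem_nhds hU)
    exact ⟨this, this⟩
  have hBp := hBp hx₀
  have hval : ∀ (x : M) (u v : ℝ × E), (coneMetric g).val (r, x) u v =
      u.1 * v.1 + (r : ℝ) ^ 2 * g.val x u.2 v.2 := fun x u v => coneForm_eq g (r, x) u v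
  have hBidem : ∀ x ∈ S, ∀ u, B (r, x) (B (r, x) u) = B (r, x) u := by
    intro x hx u
    obtain ⟨P, hP⟩ := hx.1
    obtain ⟨u, rfl⟩ := P.surjective u
    rw [hB _ _ P hx₀ hx hP, hB _ _ P hx₀ hx hP, hBp, hidem]
  have hBself : ∀ x ∈ S, ∀ u v, (coneMetric g).val (r, x) (B (r, x) u) v =
      (coneMetric g).val (r, x) u (B (r, x) v) := by
    intro x hx u v
    obtain ⟨P, hP⟩ := hx.1
    obtain ⟨u, rfl⟩ := P.surjective u
    obtain ⟨v, rfl⟩ := P.surjective v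
    rw [hB _ _ P hx₀ hx hP, hB _ _ P hx₀ hx hP, hP.val_eq, hP.val_eq, hBp, hself]
  have hBneg : ∀ x ∈ S, ∀ u, B (r, x) u ≠ 0 →
      (coneMetric g).val (r, x) (B (r, x) u) (B (r, x) u) < 0 := by
    intro x hx u hu
    obtain ⟨P, hP⟩ := hx.1
    obtain ⟨u, rfl⟩ := P.surjective u
    rw [hB _ _ P hx₀ hx hP] at hu ⊢
    rw [hP.val_eq, hBp]
    refine hneg _ fun h => hu ?_
    rw [hBp, h, map_zero]
  have hBsq : ∀ x ∈ S, ∀ u v, (coneMetric g).val (r, x) (B (r, x) u) v =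
      (coneMetric g).val (r, x) (B (r, x) u) (B (r, x) v) := by
    intro x hx u v
    rw [← hBself x hx, hBidem x hx]
  let ξ : ∀ x : M, TangentSpace (𝓘(ℝ, ℝ).prod I) ((r, x) : PosReal × M) := fun x =>
    (((r : ℝ), 0) : ℝ × E)
  let z : ∀ x : M, ℝ × E := fun x => B (r, x) (ξ x)
  let β : M → ℝ := fun x => -(coneMetric g).val (r, x) (B (r, x) (ξ x)) (ξ x)
  have hβ1 : ∀ x, β x = -((z x).1 * r) := by
    intro x
    have h := hval x (z x) (ξ x)
    have h2 : g.val x (z x).2 (0 : E) = 0 := map_zero _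
    have h3 : (coneMetric g).val (r, x) (z x) (ξ x) = (z x).1 * r + (r : ℝ) ^ 2 *
      g.val x (z x).2 (0 : E) := h
    rw [h2, mul_zero, add_zero] at h3
    exact congrArg Neg.neg h3
  have hβ2 : ∀ x ∈ S, β x = -((z x).1 * (z x).1 + (r : ℝ) ^ 2 * g.val x (z x).2 (z x).2) := by
    intro x hx
    rw [← hval]
    exact congrArg Neg.neg (hBsq x hx _ _)
  have hβnn : ∀ x ∈ S, 0 ≤ β x := by
    intro x hx
    have h : β x = -(coneMetric g).val (r, x) (B (r, x) (ξ x)) (B (r, x) (ξ x)) :=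
      congrArg Neg.neg (hBsq x hx _ _)
    rw [h]
    by_cases h0 : B (r, x) (ξ x) = 0
    · rw [h0, map_zero, neg_zero]
    · exact (neg_pos.2 (hBneg x hx _ h0)).le
  -- Eliminates the radial component `-β / r` of `z`; thus `β` vanishes wherever the slice component
  -- does.
  have hβ3 : ∀ x ∈ S, -((r : ℝ) ^ 4 * g.val x (z x).2 (z x).2) = (r : ℝ) ^ 2 * β x + β x ^ 2 := by
    intro x hx
    have h1 := hβ1 x
    have h2 := hβ2 x hx
    linear_combination (-(r : ℝ) ^ 2) * h2 + (-β x + (z x).1 * r) * h1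
  -- Local data: the derivative of `β` along segments, and the derivative of `Bξ = 0`. The metric
  -- bound is written `C ^ 2` so that `C` bounds lengths.
  have hseg : ∀ m, ∃ ε > 0,
      Metric.ball ((chartAt H m).extend I m) ε ⊆ ((chartAt H m).extend I).target ∧
      (∃ C, 0 ≤ C ∧ ∀ y ∈ Metric.ball ((chartAt H m).extend I m) ε, ∀ h,
        |coordForm g.val (chartAt H m) y h h| ≤ C ^ 2 * ‖h‖ ^ 2) ∧
      ∀ y h, y ∈ Metric.ball ((chartAt H m).extend I m) ε →
        y + h ∈ Metric.ball ((chartAt H m).extend I m) ε →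
        ((chartAt H m).extend I).symm y ∈ S →
        (∀ t ∈ Icc (0 : ℝ) 1, ((chartAt H m).extend I).symm (y + t • h) ∈ S ∧
          HasDerivWithinAt (fun t : ℝ => β (((chartAt H m).extend I).symm (y + t • h)))
            (-2 * (r : ℝ) ^ 2 * g.val (((chartAt H m).extend I).symm (y + t • h))
              (z (((chartAt H m).extend I).symm (y + t • h))).2
              (chartFrame I (chartAt H m) (y + t • h) h)) (Icc 0 1) t) ∧
        ((∀ x ∈ S, z x = 0) → (B (r, ((chartAt H m).extend I).symm y)
          ((0, chartFrame I (chartAt H m) y h) : ℝ × E) : ℝ × E) = 0) := by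
    intro m
    obtain ⟨ε₀, hε₀, hsub, ⟨C, hC⟩, hD⟩ := exists_radial_development g r m
    obtain ⟨U, hU, hUS⟩ := hlocal m
    have hm : (chartAt H m).extend I m ∈ ((chartAt H m).extend I).target :=
      hsub (Metric.mem_ball_self hε₀)
    have hcont : ContinuousAt ((chartAt H m).extend I).symm ((chartAt H m).extend I m) :=
      (mdifferentiableAt_chart_symm (chart_mem_atlas H m) hm).continuousAt
    have hU' : ((chartAt H m).extend I).symm ⁻¹' U ∈ nhds ((chartAt H m).extend I m) := by
      refine hcont.preimage_mem_nhds ?_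
      rwa [OpenPartialHomeomorph.extend_left_inv _ (mem_chart_source H m)]
    obtain ⟨ε₁, hε₁, hball⟩ := Metric.mem_nhds_iff.1 hU'
    have hs0 : Metric.ball ((chartAt H m).extend I m) (min ε₀ ε₁) ⊆
        Metric.ball ((chartAt H m).extend I m) ε₀ := Metric.ball_subset_ball (min_le_left _ _)
    have hs1 : Metric.ball ((chartAt H m).extend I m) (min ε₀ ε₁) ⊆
        Metric.ball ((chartAt H m).extend I m) ε₁ := Metric.ball_subset_ball (min_le_right _ _)
    refine ⟨min ε₀ ε₁, lt_min hε₀ hε₁, hs0.trans hsub, ⟨√(max C 0), Real.sqrt_nonneg _,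
      fun y hy h => ?_⟩, fun y h hy hyh hyS => ?_⟩
    · rw [Real.sq_sqrt (le_max_right _ _)]
      refine (hC y (hs0 hy) h).trans ?_
      gcongr
      exact le_max_left _ _
    obtain ⟨D, hD⟩ := hD y h (hs0 hy) (hs0 hyh)
    have hmemS : ∀ t ∈ Icc (0 : ℝ) 1, ((chartAt H m).extend I).symm (y + t • h) ∈ S :=
      fun t ht => hUS _ (hball (hs1 hy)) hyS
        (hball (hs1 ((convex_ball _ _).add_smul_mem hy hyh ht)))
    -- Pulled back to `y`, the field `B` is the fixed map `L`, and `β` along the segment is the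
    -- fixed quadratic form `-N` at the moving vector `D t`.
    let L : ℝ × E →L[ℝ] ℝ × E := LinearMap.toContinuousLinearMap
      (show ℝ × E →ₗ[ℝ] ℝ × E from B (r, ((chartAt H m).extend I).symm y))
    let N : ℝ × E →L[ℝ] ℝ × E →L[ℝ] ℝ :=
      (show ℝ × E →L[ℝ] ℝ × E →L[ℝ] ℝ from
        (coneMetric g).val (r, ((chartAt H m).extend I).symm y)) ∘L L
    have hNsymm : ∀ u v, N u v = N v u := fun u v =>
      (hBself _ hyS u v).trans ((coneMetric g).symm _ _ _)
    have hQval : ∀ t ∈ Icc (0 : ℝ) 1, ∀ Q, IsParallelTransport (coneMetric g)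
        ((r, ((chartAt H m).extend I).symm y) : PosReal × M)
        (r, ((chartAt H m).extend I).symm (y + t • h)) Q → ∀ u v,
        (coneMetric g).val _ (B _ (Q u)) (Q v) = (coneMetric g).val _ (B _ u) v := by
      intro t ht Q hQ u v
      rw [hB _ _ Q hyS (hmemS t ht) hQ, hQ.val_eq]
    have hQzero : ∀ t ∈ Icc (0 : ℝ) 1, ∀ Q, IsParallelTransport (coneMetric g)
        ((r, ((chartAt H m).extend I).symm y) : PosReal × M)
        (r, ((chartAt H m).extend I).symm (y + t • h)) Q → ∀ u,
        B _ (Q u) = 0 ↔ B _ u = 0 := by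
      intro t ht Q hQ u
      rw [hB _ _ Q hyS (hmemS t ht) hQ]
      exact map_eq_zero_iff Q Q.injective
    have hNβ : ∀ t ∈ Icc (0 : ℝ) 1,
        β (((chartAt H m).extend I).symm (y + t • h)) = -N (D t) (D t) := by
      intro t ht
      obtain ⟨_, _, Q, hQ, hQ1, _⟩ := hD t ht
      have e1 : ξ (((chartAt H m).extend I).symm (y + t • h)) = Q (D t) := hQ1.symm
      have e2 : β (((chartAt H m).extend I).symm (y + t • h)) =
        -(coneMetric g).val _ (B _ (Q (D t))) (Q (D t)) := by rw [← e1]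
      exact e2.trans (congrArg Neg.neg (hQval t ht Q hQ (D t) (D t)))
    refine ⟨fun t ht => ⟨hmemS t ht, ?_⟩, fun hz => ?_⟩
    · obtain ⟨D', hd, Q, hQ, hQ1, hQ2⟩ := hD t ht
      have h1 := ((N.hasFDerivAt.comp_hasDerivWithinAt t hd).clm_apply hd).neg
      refine (h1.congr_of_mem hNβ ht).congr_deriv ?_
      have e1 : ξ (((chartAt H m).extend I).symm (y + t • h)) = Q (D t) := hQ1.symm
      have h2 : N (D t) D' = (coneMetric g).val (r, ((chartAt H m).extend I).symm (y + t • h))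
          (z (((chartAt H m).extend I).symm (y + t • h)))
          ((0, chartFrame I (chartAt H m) (y + t • h) h) : ℝ × E) := by
        have e3 : z (((chartAt H m).extend I).symm (y + t • h)) = B _ (Q (D t)) := by rw [← e1]
        have e4 : ((0, chartFrame I (chartAt H m) (y + t • h) h) : ℝ × E) = Q D' := hQ2.symm
        rw [e3, e4]
        exact (hQval t ht Q hQ (D t) D').symm
      rw [hval] at h2
      simp only [mul_zero, zero_add] at h2
      have h3 := hNsymm D' (D t)
      simp only [Function.comp_apply]
      rw [h3, h2]
      ring
    · have h0 : (0 : ℝ) ∈ Icc (0 : ℝ) 1 := by simp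
      obtain ⟨D', hd, Q, hQ, hQ1, hQ2⟩ := hD 0 h0
      have hLD : ∀ t ∈ Icc (0 : ℝ) 1, L (D t) = 0 := by
        intro t ht
        obtain ⟨_, _, Q, hQ, hQ1, _⟩ := hD t ht
        have e1 : ξ (((chartAt H m).extend I).symm (y + t • h)) = Q (D t) := hQ1.symm
        have e2 : B _ (ξ (((chartAt H m).extend I).symm (y + t • h))) = 0 := hz _ (hmemS t ht)
        rw [e1] at e2
        exact (hQzero t ht Q hQ (D t)).1 e2
      -- `D` stays in the kernel of `L`, hence so does its one-sided derivative at `0`.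
      have h1 : L D' = 0 := by
        have h2 := L.hasFDerivAt.comp_hasDerivWithinAt (0 : ℝ) hd
        have h3 := (hasDerivWithinAt_const (0 : ℝ) (Icc (0 : ℝ) 1) (0 : ℝ × E)).congr_of_mem
          (f₁ := L ∘ D) hLD h0
        exact (uniqueDiffOn_Icc zero_lt_one 0 h0).eq_deriv _ h2 h3
      have h4 : B _ (Q D') = 0 := (hQzero 0 h0 Q hQ D').2 h1
      have h5 : (B (r, ((chartAt H m).extend I).symm (y + (0 : ℝ) • h))
          ((0, chartFrame I (chartAt H m) (y + (0 : ℝ) • h) h) : ℝ × E) : ℝ × E) = 0 := by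
        have e4 : ((0, chartFrame I (chartAt H m) (y + (0 : ℝ) • h) h) : ℝ × E) = Q D' := hQ2.symm
        rw [e4]
        exact h4
      have hy0 : y + (0 : ℝ) • h = y := by simp
      rw [hy0] at h5
      exact h5
  -- Cauchy-Schwarz and `hβ3` bound the derivative of `β` by `2 C ‖h‖ (β + r²)`; the logarithm
  -- absorbs the factor depending on `β`, for which no a priori bound is known.
  have hlog : ContinuousOn (fun x => Real.log (β x + (r : ℝ) ^ 2)) S := by
    intro m hmS
    refine ContinuousAt.continuousWithinAt ?_
    obtain ⟨ε, hε, hsub, ⟨C, hC0, hC⟩, hD⟩ := hseg m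
    have hcont := (chartAt H m).continuousAt_extend (I := I) (mem_chart_source H m)
    have hmm : ((chartAt H m).extend I).symm ((chartAt H m).extend I m) = m :=
      OpenPartialHomeomorph.extend_left_inv _ (mem_chart_source H m)
    have hlip : ∀ᶠ x in nhds m, ‖Real.log (β x + (r : ℝ) ^ 2) - Real.log (β m + (r : ℝ) ^ 2)‖ ≤
        2 * C * ‖(chartAt H m).extend I x - (chartAt H m).extend I m‖ := by
      filter_upwards [hcont.preimage_mem_nhds (Metric.ball_mem_nhds _ hε),
        (chartAt H m).open_source.mem_nhds (mem_chart_source H m)] with x hx hxs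
      have hxx : ((chartAt H m).extend I).symm ((chartAt H m).extend I x) = x :=
        OpenPartialHomeomorph.extend_left_inv _ hxs
      set y := (chartAt H m).extend I m
      set h := (chartAt H m).extend I x - y with hh
      have hyh : y + h = (chartAt H m).extend I x := add_sub_cancel _ _
      have hy : y ∈ Metric.ball y ε := Metric.mem_ball_self hε
      have hyh' : y + h ∈ Metric.ball y ε := by rw [hyh]; exact hx
      obtain ⟨hd, -⟩ := hD y h hy hyh' (by rwa [hmm])
      have hpos : ∀ t ∈ Icc (0 : ℝ) 1,
          0 < β (((chartAt H m).extend I).symm (y + t • h)) + (r : ℝ) ^ 2 := fun t ht =>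
        add_pos_of_nonneg_of_pos (hβnn _ (hd t ht).1) (pow_pos hr 2)
      have key := (convex_Icc (0 : ℝ) 1).norm_image_sub_le_of_norm_hasDerivWithin_le
        (f := fun t => Real.log (β (((chartAt H m).extend I).symm (y + t • h)) + (r : ℝ) ^ 2))
        (C := 2 * C * ‖h‖)
        (fun t ht => ((hd t ht).2.add_const ((r : ℝ) ^ 2)).log (hpos t ht).ne')
        (fun t ht => ?_) (left_mem_Icc.2 zero_le_one) (right_mem_Icc.2 zero_le_one)
      · simp only [one_smul, zero_smul, add_zero, sub_zero, norm_one, mul_one] at key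
        rwa [hyh, hxx, hmm] at key
      · rw [norm_div, Real.norm_eq_abs, Real.norm_eq_abs, abs_of_pos (hpos t ht),
          div_le_iff₀ (hpos t ht)]
        set q := ((chartAt H m).extend I).symm (y + t • h)
        set k := chartFrame I (chartAt H m) (y + t • h) h
        have hb := hβnn q (hd t ht).1
        have h3 := hβ3 q (hd t ht).1
        have h1 := hg.sq_val_le q (z q).2 k
        have h2 : |g.val q k k| ≤ C ^ 2 * ‖h‖ ^ 2 :=
          hC _ ((convex_ball _ _).add_smul_mem hy hyh' ht) h
        rw [abs_of_nonpos (hg.val_nonpos q k)] at h2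
        refine abs_le_of_sq_le_sq ?_ (by positivity)
        have h4 : (-2 * (r : ℝ) ^ 2 * g.val q (z q).2 k) ^ 2 ≤
            4 * ((r : ℝ) ^ 2 * β q + β q ^ 2) * (-g.val q k k) := by
          rw [← h3]
          nlinarith [mul_le_mul_of_nonneg_left h1 (pow_nonneg hr.le 4)]
        calc _ ≤ 4 * ((r : ℝ) ^ 2 * β q + β q ^ 2) * (-g.val q k k) := h4
          _ ≤ 4 * (β q + (r : ℝ) ^ 2) ^ 2 * (C ^ 2 * ‖h‖ ^ 2) := by
            have h5 : 0 ≤ (r : ℝ) ^ 2 * β q := by positivity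
            have h6 : 0 ≤ (r : ℝ) ^ 4 := by positivity
            refine mul_le_mul ?_ h2 (neg_nonneg.2 (hg.val_nonpos q k)) (by positivity)
            nlinarith
          _ = _ := by ring
    have hlim : Filter.Tendsto
        (fun x => 2 * C * ‖(chartAt H m).extend I x - (chartAt H m).extend I m‖) (nhds m)
        (nhds 0) := by
      have := ((hcont.sub (continuousAt_const (y := (chartAt H m).extend I m))).norm).const_mul
        (2 * C)
      simpa [ContinuousAt] using this
    exact tendsto_iff_norm_sub_tendsto_zero.2
      (squeeze_zero' (Filter.Eventually.of_forall fun _ => norm_nonneg _) hlip hlim)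
  obtain ⟨m, hmS, hmax⟩ := hclosed.isCompact.exists_isMaxOn ⟨x₀, hx₀⟩ hlog
  have hβmax : ∀ x ∈ S, β x ≤ β m := by
    intro x hx
    have h1 := (Real.log_le_log_iff (add_pos_of_nonneg_of_pos (hβnn x hx) (pow_pos hr 2))
      (add_pos_of_nonneg_of_pos (hβnn m hmS) (pow_pos hr 2))).1 (hmax hx)
    linarith
  have hscale : ∀ {ε : ℝ}, 0 < ε → ∀ y h : E, ∃ δ : ℝ, 0 < δ ∧ y + δ • h ∈ Metric.ball y ε := by
    intro ε hε y h
    refine ⟨ε / (2 * (‖h‖ + 1)), by positivity, ?_⟩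
    rw [Metric.mem_ball, dist_eq_norm, add_sub_cancel_left, norm_smul, Real.norm_eq_abs,
      abs_of_pos (by positivity), div_mul_eq_mul_div, div_lt_iff₀ (by positivity)]
    nlinarith [norm_nonneg h]
  have hβm : β m = 0 := by
    obtain ⟨ε, hε, hsub, -, hD⟩ := hseg m
    set y := (chartAt H m).extend I m
    have hy : y ∈ Metric.ball y ε := Metric.mem_ball_self hε
    have hmm : ((chartAt H m).extend I).symm y = m :=
      OpenPartialHomeomorph.extend_left_inv _ (mem_chart_source H m)
    -- Moving in the direction of the slice component of `z`, the derivative `-2 r² δ g(z₂, z₂)` is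
    -- nonnegative; maximality at the left endpoint makes it nonpositive.
    obtain ⟨h, hh⟩ := (chartFrame_bijective (I := I) (chart_mem_atlas H m) (hsub hy)).2
      (z (((chartAt H m).extend I).symm y)).2
    obtain ⟨δ, hδ, hyδ⟩ := hscale hε y h
    obtain ⟨hd, -⟩ := hD y (δ • h) hy hyδ (by rwa [hmm])
    have h0 := (hd 0 (by simp)).2
    have hsmul : ∀ (x : M) (u v w : TangentSpace I x), v = δ • w →
        g.val x u v = δ * g.val x u w := by
      rintro x u _ w rfl
      rw [map_smul, smul_eq_mul]
    rw [zero_smul, add_zero] at h0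
    replace h0 : HasDerivWithinAt
        (fun t : ℝ => β (((chartAt H m).extend I).symm (y + t • δ • h)))
        (-2 * (r : ℝ) ^ 2 * (δ * g.val (((chartAt H m).extend I).symm y)
          (z (((chartAt H m).extend I).symm y)).2 (z (((chartAt H m).extend I).symm y)).2))
        (Icc 0 1) 0 :=
      h0.congr_deriv (congrArg _ (hsmul _ _ _ _ ((map_smul _ _ _).trans (congrArg (δ • ·) hh))))
    rw [hmm] at h0
    have hloc : IsLocalMaxOn (fun t : ℝ => β (((chartAt H m).extend I).symm (y + t • δ • h)))
        (Icc 0 1) 0 := by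
      refine Filter.eventually_of_mem self_mem_nhdsWithin fun t ht => ?_
      simp only [zero_smul, add_zero, hmm]
      exact hβmax _ (hd t ht).1
    have h1 := hloc.hasFDerivWithinAt_nonpos h0.hasFDerivWithinAt
      (y := 1) (mem_posTangentConeAt_of_segment_subset
        ((convex_Icc (0 : ℝ) 1).segment_subset (by simp) (by simp)))
    have h2 := hg.val_nonpos m (z m).2
    have h3 := hβ3 m hmS
    have h4 : -2 * (r : ℝ) ^ 2 * (δ * g.val m (z m).2 (z m).2) ≤ 0 := by simpa using h1
    have h5 : 0 ≤ g.val m (z m).2 (z m).2 := by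
      by_contra! hlt
      have : 0 < (r : ℝ) ^ 2 * (δ * -g.val m (z m).2 (z m).2) :=
        mul_pos (pow_pos hr 2) (mul_pos hδ (neg_pos.2 hlt))
      linarith
    have h6 : g.val m (z m).2 (z m).2 = 0 := le_antisymm h2 h5
    rw [h6, mul_zero, neg_zero] at h3
    have h7 : 0 ≤ (r : ℝ) ^ 2 * β m := mul_nonneg (sq_nonneg _) (hβnn m hmS)
    exact pow_eq_zero_iff (two_ne_zero) |>.1 (by linarith [sq_nonneg (β m)] : β m ^ 2 = 0)
  have hz : ∀ x ∈ S, z x = 0 := by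
    intro x hx
    by_contra hne
    have h1 : β x = -(coneMetric g).val (r, x) (B (r, x) (ξ x)) (B (r, x) (ξ x)) :=
      congrArg Neg.neg (hBsq x hx _ _)
    have h2 := hBneg x hx _ hne
    have h3 := hβmax x hx
    linarith
  obtain ⟨ε, hε, hsub, -, hD⟩ := hseg x₀
  set y := (chartAt H x₀).extend I x₀
  have hy : y ∈ Metric.ball y ε := Metric.mem_ball_self hε
  have hxx : ((chartAt H x₀).extend I).symm y = x₀ :=
    OpenPartialHomeomorph.extend_left_inv _ (mem_chart_source H x₀)
  have hBy : B (r, ((chartAt H x₀).extend I).symm y) = 0 := by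
    refine LinearMap.ext fun u => ?_
    obtain ⟨u₁, u₂⟩ := u
    obtain ⟨h, rfl⟩ := (chartFrame_bijective (I := I) (chart_mem_atlas H x₀) (hsub hy)).2 u₂
    obtain ⟨δ, hδ, hyδ⟩ := hscale hε y h
    have h1 := (hD y (δ • h) hy hyδ (by rwa [hxx])).2 hz
    have h2 : B (r, ((chartAt H x₀).extend I).symm y)
        (ξ (((chartAt H x₀).extend I).symm y)) = 0 := hz _ (by rwa [hxx])
    -- Every tangent vector is a multiple of `ξ` plus a slice vector; `δ⁻¹` undoes the shrinking of
    -- `h` into the ball.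
    have h3 : ∀ a b c : TangentSpace (𝓘(ℝ, ℝ).prod I)
        ((r, ((chartAt H x₀).extend I).symm y) : PosReal × M), B _ a = 0 → B _ b = 0 →
        c = (u₁ / (r : ℝ)) • a + δ⁻¹ • b → B _ c = 0 := by
      rintro a b _ ha hb rfl
      rw [map_add, map_smul, map_smul, ha, hb, smul_zero, smul_zero, add_zero]
    refine h3 _ _ _ h2 h1 (Prod.ext ?_ ?_)
    · have : u₁ = (u₁ / r) * r + δ⁻¹ * 0 := by field_simp; ring
      exact this
    · have : chartFrame I (chartAt H x₀) y h = (u₁ / (r : ℝ)) • 0 +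
          δ⁻¹ • chartFrame I (chartAt H x₀) y (δ • h) := by
        rw [map_smul, smul_zero, zero_add, smul_smul, inv_mul_cancel₀ hδ.ne', one_smul]
      exact this
  rw [hxx, hBp] at hBy
  exact hBy

end Indecomposability

/-! ### Orthogonal projections for indefinite forms. -/

/-- The orthogonal projection onto a nondegenerate subspace. -/
theorem exists_orthogonal_projection {V : Type*} [AddCommGroup V] [Module ℝ V]
    [FiniteDimensional ℝ V] (b : V →ₗ[ℝ] V →ₗ[ℝ] ℝ)
    (U : Submodule ℝ V) (hU : ∀ u ∈ U, (∀ w ∈ U, b u w = 0) → u = 0) :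
    ∃ A : V →ₗ[ℝ] V, (∀ u, A u ∈ U) ∧ (∀ u ∈ U, A u = u) ∧ ∀ u, ∀ w ∈ U, b (u - A u) w = 0 := by
  let ι : U →ₗ[ℝ] Module.Dual ℝ U := b.compl₁₂ U.subtype U.subtype
  have hinj : Function.Injective ι := by
    rw [← LinearMap.ker_eq_bot, LinearMap.ker_eq_bot']
    intro u hu
    exact Subtype.ext (hU u u.2 fun w hw =>
      congrArg (fun L : Module.Dual ℝ U => L ⟨w, hw⟩) hu)
  let e : U ≃ₗ[ℝ] Module.Dual ℝ U :=
    LinearEquiv.ofInjectiveOfFinrankEq ι hinj Subspace.dual_finrank_eq.symm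
  -- Riesz representation inside `U` of the functional `b u` restricted to `U`.
  let A₀ : V →ₗ[ℝ] U := e.symm.toLinearMap ∘ₗ (b.compl₂ U.subtype)
  have hA₀ : ∀ u (w : U), b (A₀ u) w = b u w := fun u w =>
    congrArg (fun L : Module.Dual ℝ U => L w) (e.apply_symm_apply ((b.compl₂ U.subtype) u))
  refine ⟨U.subtype ∘ₗ A₀, fun u => (A₀ u).2, fun u hu => ?_, fun u w hw => ?_⟩
  · refine sub_eq_zero.1 (hU _ (U.sub_mem (A₀ u).2 hu) fun w hw => ?_)
    rw [map_sub, LinearMap.sub_apply, sub_eq_zero]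
    exact hA₀ u ⟨w, hw⟩
  · rw [map_sub, LinearMap.sub_apply, sub_eq_zero]
    exact (hA₀ u ⟨w, hw⟩).symm

/-! ### Lorentzian signature and the conclusion. -/

section Main

variable {E : Type*} [NormedAddCommGroup E] [NormedSpace ℝ E]
  {H : Type*} [TopologicalSpace H] {I : ModelWithCorners ℝ E H}
  {M : Type*} [TopologicalSpace M] [ChartedSpace H M]

/-- On the kernel of `dx₀` the cone form is `x₀² g`, which is negative definite. -/
theorem eq_zero_of_coneDx_eq_zero {g : Metric I M} (hg : g.IsNegativeDefinite) {p : PosReal × M}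
    {v : TangentSpace (𝓘(ℝ, ℝ).prod I) p} (h1 : coneDx I p v = 0) (h2 : 0 ≤ coneForm g p v v) :
    v = 0 := by
  have hp : 0 < coneCoord p ^ 2 := pow_pos (show (0 : ℝ) < coneCoord p from p.1.2) 2
  rw [coneForm_apply, h1, mul_zero, zero_add] at h2
  have h3 : coneProj I p v = 0 := by
    by_contra hne
    exact absurd h2 (not_le.2 (mul_neg_of_pos_of_neg hp (hg _ _ hne)))
  rw [coneDx_apply] at h1
  rw [coneProj_apply] at h3
  exact Prod.ext h1 h3

/-- In a Lorentzian tangent space of the cone, two orthogonal independent vectors do not both have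
nonnegative square. -/
theorem eq_zero_or_eq_zero_of_orthogonal {g : Metric I M} (hg : g.IsNegativeDefinite)
    {p : PosReal × M} {a c : TangentSpace (𝓘(ℝ, ℝ).prod I) p} (ha : 0 ≤ coneForm g p a a)
    (hc : 0 ≤ coneForm g p c c) (hac : coneForm g p a c = 0) (hca : coneForm g p c a = 0)
    (hind : ∀ s t : ℝ, s • a = t • c → s • a = 0) : a = 0 ∨ c = 0 := by
  -- This combination is killed by `dx₀`, while orthogonality makes its square a nonnegative
  -- combination of those of `a` and `c`.
  have h1 : coneDx I p c • a - coneDx I p a • c = 0 := by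
    refine eq_zero_of_coneDx_eq_zero hg ?_ ?_
    · rw [map_sub, map_smul, map_smul, smul_eq_mul, smul_eq_mul, mul_comm, sub_self]
    · simp only [map_sub, map_smul, _root_.sub_apply, _root_.smul_apply, smul_eq_mul, hac, hca,
        mul_zero, sub_zero, zero_sub]
      have e1 := mul_nonneg (mul_self_nonneg (coneDx I p c)) ha
      have e2 := mul_nonneg (mul_self_nonneg (coneDx I p a)) hc
      linarith
  have h2 := hind _ _ (sub_eq_zero.1 h1)
  have h3 := (sub_eq_zero.1 h1).symm.trans h2
  rcases smul_eq_zero.1 h3 with h | h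
  · exact Or.inl (eq_zero_of_coneDx_eq_zero hg h ha)
  · exact Or.inr h

/-- The cone over a compact negative-definite manifold is not decomposable. -/
theorem not_isDecomposable_coneMetric [IsManifold I ∞ M] [I.Boundaryless] [FiniteDimensional ℝ E]
    [CompactSpace M] (g : Metric I M) (hg : g.IsNegativeDefinite) :
    ¬ (coneMetric g).IsDecomposable := by
  rintro ⟨p, U, hbot, htop, hnd, hinv⟩
  have hfin : FiniteDimensional ℝ (TangentSpace (𝓘(ℝ, ℝ).prod I) p) :=
    inferInstanceAs (FiniteDimensional ℝ (ℝ × E))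
  set b := (coneMetric g).val p with hb
  have hsymm : ∀ u v, b u v = b v u := (coneMetric g).symm p
  obtain ⟨A, hAU, hAid, hAorth⟩ := exists_orthogonal_projection
    (LinearMap.mk₂ ℝ (fun u v => b u v) (by simp) (by simp) (by simp) (by simp)) U hnd
  replace hAorth : ∀ u, ∀ w ∈ U, b (u - A u) w = 0 := hAorth
  have hidem : ∀ u, A (A u) = A u := fun u => hAid _ (hAU u)
  have hself : ∀ u v, b (A u) v = b u (A v) := by
    intro u v
    have h1 := hAorth v (A u) (hAU u)
    have h2 := hAorth u (A v) (hAU v)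
    rw [map_sub, _root_.sub_apply, sub_eq_zero] at h1 h2
    rw [h2, hsymm (A u) v, h1, hsymm]
  have hcomm : ∀ P ∈ holonomyGroup (coneMetric g) p, ∀ u, A (P u) = P (A u) := by
    intro P hP u
    have hPA := hinv P hP _ (hAU u)
    refine sub_eq_zero.1 (hnd _ (U.sub_mem (hAU _) hPA) fun w hw => ?_)
    have h1 := hAorth (P u) w hw
    have hw' := hinv _ (Subgroup.inv_mem _ hP) w hw
    have h2 := hAorth u _ hw'
    have h3 : P (P⁻¹ w) = w := by
      rw [← LinearEquiv.mul_apply, mul_inv_cancel]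
      rfl
    rw [hb, ← val_eq_of_mem_holonomyGroup hP, h3, map_sub P] at h2
    rw [map_sub, _root_.sub_apply, sub_eq_zero] at h1 h2 ⊢
    rw [← h1, h2]
  let A' : TangentSpace (𝓘(ℝ, ℝ).prod I) p →ₗ[ℝ] TangentSpace (𝓘(ℝ, ℝ).prod I) p :=
    LinearMap.id - A
  have hA' : ∀ u, A' u = u - A u := fun u => rfl
  have hAA' : ∀ u, A (A' u) = 0 := fun u => by rw [hA', map_sub, hidem, sub_self]
  have hne : A ≠ 0 := by
    rintro rfl
    exact hbot ((Submodule.eq_bot_iff U).2 fun u hu => (hAid u hu).symm)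
  have hne' : A' ≠ 0 := by
    intro h
    refine htop (Submodule.eq_top_iff'.2 fun u => ?_)
    have h1 : u - A u = 0 := LinearMap.congr_fun h u
    rw [sub_eq_zero.1 h1]
    exact hAU u
  -- If the image of `A` contains a nonzero vector of nonnegative square, the signature forces the
  -- image of `A'` to be negative definite.
  by_cases hneg : ∀ u, A u ≠ 0 → b (A u) (A u) < 0
  · exact hne (parallel_projection_eq_zero g hg p A hcomm hidem hself hneg)
  · refine hne' (parallel_projection_eq_zero g hg p A' (fun P hP u => ?_) (fun u => ?_)
      (fun u v => ?_) (fun w hw => ?_))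
    · rw [hA', hA', hcomm P hP, map_sub]
    · rw [hA' (A' u), hAA', sub_zero]
    · rw [hA', hA', map_sub, map_sub, _root_.sub_apply, ← hb, hself]
    · push Not at hneg
      obtain ⟨u, hu, hu'⟩ := hneg
      by_contra hw'
      have horth : b (A' w) (A u) = 0 := hAorth w _ (hAU u)
      have hind : ∀ s t : ℝ, s • A u = t • A' w → s • A u = 0 := by
        intro s t hst
        have := congrArg A hst
        rwa [map_smul, map_smul, hidem, hAA', smul_zero] at this
      rcases eq_zero_or_eq_zero_of_orthogonal hg hu' (not_lt.1 hw')
        ((hsymm _ _).trans horth) horth hind with h | h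
      · exact hu h
      · exact hw h

end Main

end PseudoRiem

theorem corollary2 (n : ℕ) (M : Type*) [TopologicalSpace M]
    [ChartedSpace (EuclideanSpace ℝ (Fin n)) M] [IsManifold (𝓡 n) ∞ M]
    [T2Space M] [CompactSpace M]
    (g : PseudoRiem.Metric (𝓡 n) M) (hg : g.IsNegativeDefinite) :
    ¬ (PseudoRiem.coneMetric g).IsDecomposable :=
  PseudoRiem.not_isDecomposable_coneMetric g hg
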